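/- Let $\mathcal X$ be a real Hilbert space and let $\Gamma_0(E)$ denote the proper lower semicontinuous convex functions $E\to(-\infty,\infty]$ on a real Hilbert space $E$; for $\varphi\in\Gamma_0(E)$ let $\operatorname{prox}_\varphi(x)$ be the unique minimizer of $y\mapsto\varphi(y)+\tfrac12\|y-x\|^2$. Let $f\in\Gamma_0(\mathcal X)$, $g_1,\dots,g_m\in\Gamma_0(\mathbb R)$, $g(y)=\sum_{i=1}^m g_i(y_i)$ on $\mathbb R^m$, and $Ax=(A_1x,\dots,A_mx)$ with nonzero bounded linear functionals $A_i:\mathcal X\to\mathbb R$. Put $\mathcal S_p:=\operatorname{argmin}_{x\in\mathcal X}\,[f(x)+g(Ax)]$. Assume that $\mathcal S_p\neq\varnothing$ and that the qualification condition $0\in\operatorname{sri}(\operatorname{dom} g-A\operatorname{dom} f)$ holds, where $\operatorname{sri}(C)$ is the set of $x\in C$ for which $\{t(y-x): t>0,\ y\in C\}$ equals the closed linear span of $C-x$. Let $\Psi\in\Gamma_0(\mathcal X)$ be real valued and Gâteaux differentiable on $\mathcal X$ with Lipschitz continuous gradient $\nabla\Psi$, and assume $\Omega:=\operatorname{argmin}_{x\in\mathcal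 S_p}\Psi(x)\neq\varnothing$. For $\mathbf x=(x^{(1)},\dots,x^{(m+1)})$ in the Hilbert space $\mathcal X^{m+1}$ write $\bar x=\frac1{m+1}\sum_{j=1}^{m+1}x^{(j)}$, $H(\mathbf x)=\sum_{i=1}^m g_i(A_ix^{(i)})+f(x^{(m+1)})$, $D=\{\mathbf x: x^{(i)}=x^{(j)}\ \forall i,j\}$, let $\iota_D$ be the indicator function of $D$ ($0$ on $D$ and $+\infty$ outside), let $P_D$ be the metric projection onto $D$, and let $\Xi(\mathbf x)$ be the first coordinate of $P_D\mathbf x$. Define $T\mathbf x=(x_T^{(1)},\dots,x_T^{(m+1)})$ by $$x_T^{(i)}=(2\bar x-x^{(i)})+2(A_iA_i^*)^{-1}A_i^*\big(\operatorname{prox}_{(A_iA_i^*)g_i}[A_i(2\bar x-x^{(i)})]-A_i(2\bar x-x^{(i)})\big)\quad(1\le i\le m),$$ $$x_T^{(m+1)}=2\operatorname{prox}_f(2\bar x-x^{(m+1)})-(2\bar x-x^{(m+1)}).$$ Then: (a) $A_iA_i^*$ is a positive number (so that no matrix inversion is needed) and $\operatorname{prox}_{g_i\circ A_i}(u)=u+(A_iA_i^*)^{-1}A_i^*(\operatorname{prox}_{(A_iA_i^*)g_i}(A_iu)-A_iu)$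 for all $u\in\mathcal X$; $H\in\Gamma_0(\mathcal X^{m+1})$ and $\operatorname{prox}_H(\mathbf x)=(\operatorname{prox}_{g_1\circ A_1}(x^{(1)}),\dots,\operatorname{prox}_{g_m\circ A_m}(x^{(m)}),\operatorname{prox}_f(x^{(m+1)}))$; $\operatorname{prox}_{\iota_D}(\mathbf x)=P_D\mathbf x=(\bar x,\dots,\bar x)$; and $T=(2\operatorname{prox}_H-\mathrm I)\circ(2P_D-\mathrm I)$ is nonexpansive. (b) $\mathcal S_p=\Xi(\operatorname{Fix}T)$. For every $\alpha\in(0,1)$ the operator $T_\alpha:=(1-\alpha)\mathrm I+\alpha T$ satisfies $\operatorname{Fix}T_\alpha=\operatorname{Fix}T\ne\varnothing$ and is attracting nonexpansive, that is, it is nonexpansive and $\|T_\alpha\mathbf x-\mathbf z\|<\|\mathbf x-\mathbf z\|$ for all $\mathbf x\notin\operatorname{Fix}T_\alpha$, $\mathbf z\in\operatorname{Fix}T_\alpha$. (c) $\Theta:=\Psi\circ\Xi\in\Gamma_0(\mathcal X^{m+1})$ is Gâteaux differentiable with Lipschitz continuous gradient $\nabla\Theta=\Xi^*\circ\nabla\Psi\circ\Xi$,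 and $\Omega=\Xi\big(\operatorname{argmin}_{\operatorname{Fix}T}\Theta\big)$. (d) Let $\alpha\in(0,1)$ and let $(\lambda_{n+1})_{n\in\mathbb N}$ be a nonnegative sequence with $\sum_n\lambda_{n+1}^2<\infty$ and $\sum_n\lambda_{n+1}=\infty$. The iteration $$(x_{n+1/2}^{(1)},\dots,x_{n+1/2}^{(m+1)})=(1-\alpha)(x_n^{(1)},\dots,x_n^{(m+1)})+\alpha T(x_n^{(1)},\dots,x_n^{(m+1)}),$$ $$x^\star_{n+1}=\frac1{m+1}\sum_{j=1}^{m+1}x_{n+1/2}^{(j)},\qquad x_{n+1}^{(i)}=x_{n+1/2}^{(i)}-\frac{\lambda_{n+1}}{m+1}\nabla\Psi(x_{n+1}^\star)\quad(1\le i\le m+1)$$ is the hybrid steepest descent method $\mathbf x_{n+1}=T_\alpha\mathbf x_n-\lambda_{n+1}\nabla\Theta(T_\alpha\mathbf x_n)$. If $\dim\mathcal X<\infty$ and $\operatorname{Fix}T$ is bounded, then for every starting point $(x_0^{(1)},\dots,x_0^{(m+1)})\in\mathcal X^{m+1}$ it generates a sequence $(x_{n+1}^\star)$ with $\lim_{n\to\infty}d_\Omega(x_n^\star)=0$,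 where $d_\Omega(x)=\inf_{y\in\Omega}\|x-y\|$. -/

import Mathlib

open Filter Topology Function

noncomputable section

namespace HSDM

/-! ### Convex analysis on a real Hilbert space -/

section Convex

variable {E : Type*} [NormedAddCommGroup E] [InnerProductSpace ℝ E]

/-- The minimizers of `F` over `S`. -/
def argminOn {α β : Type*} [LE β] (F : α → β) (S : Set α) : Set α :=
  {x | x ∈ S ∧ ∀ y ∈ S, F x ≤ F y}

/-- The effective domain of an extended real valued function. -/
def effDom {α : Type*} (F : α → EReal) : Set α := {x | F x < ⊤}

/-- `F ∈ Γ₀(E)`: a proper lower semicontinuous convex function `E → (-∞, ∞]`. -/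
structure IsGammaZero (F : E → EReal) : Prop where
  ne_bot : ∀ x, F x ≠ ⊥
  proper : (effDom F).Nonempty
  lsc : LowerSemicontinuous F
  convex : ∀ x ∈ effDom F, ∀ y ∈ effDom F, ∀ t : ℝ, 0 < t → t < 1 →
    F (t • x + (1 - t) • y) ≤ (t : EReal) * F x + ((1 - t : ℝ) : EReal) * F y

/-- The set of minimizers of `y ↦ F y + ‖y - x‖² / 2`. -/
def proxSet (F : E → EReal) (x : E) : Set E :=
  argminOn (fun y => F y + (((1 / 2) * ‖y - x‖ ^ 2 : ℝ) : EReal)) Set.univ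

/-- The proximity operator: the point of `proxSet F x`, which is unique for `F ∈ Γ₀(E)`. -/
def prox (F : E → EReal) (x : E) : E := Classical.epsilon fun p => p ∈ proxSet F x

/-- The indicator function of a set: `0` on `C` and `+∞` outside. -/
def indicatorFn {α : Type*} (C : Set α) : α → EReal :=
  open Classical in fun x => if x ∈ C then 0 else ⊤

/-- The conical hull `{t x | t > 0, x ∈ C}`. -/
def conicalHull (C : Set E) : Set E := {z | ∃ t : ℝ, 0 < t ∧ ∃ x ∈ C, z = t • x}

/-- The strong relative interior: the `x ∈ C` for which the conical hull of `C - x` is the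
closed linear span of `C - x`. -/
def sri (C : Set E) : Set E :=
  {x | x ∈ C ∧ conicalHull ((fun y => y - x) '' C) =
    ((Submodule.span ℝ ((fun y => y - x) '' C)).topologicalClosure : Set E)}

/-- `a` is the Gâteaux gradient of `F` at `x`. -/
def HasGateauxGradientAt (F : E → ℝ) (a x : E) : Prop :=
  ∀ h : E, HasLineDerivAt ℝ F (inner ℝ a h) x h

/-- An attracting nonexpansive operator (with a fixed point). -/
def IsAttractingNonexpansive (T : E → E) : Prop :=
  LipschitzWith 1 T ∧ (fixedPoints T).Nonempty ∧
    ∀ x, x ∉ fixedPoints T → ∀ z ∈ fixedPoints T, ‖T x - z‖ < ‖x - z‖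

/-- `(1 - α) I + α T`. -/
def relax (α : ℝ) (T : E → E) (x : E) : E := (1 - α) • x + α • T x

end Convex

/-! ### The first stage problem: minimize `f x + ∑ i, g i (A i x)` -/

section Problem

variable {X : Type*} [NormedAddCommGroup X] [InnerProductSpace ℝ X] {m : ℕ}

/-- `g = ⨁ i, g i` on `ℝᵐ`. -/
def directSum (g : Fin m → ℝ → EReal) (y : EuclideanSpace ℝ (Fin m)) : EReal := ∑ i, g i (y i)

/-- `A x = (A₁ x, …, Aₘ x)`. -/
def stack (A : Fin m → X →L[ℝ] ℝ) (x : X) : EuclideanSpace ℝ (Fin m) :=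
  WithLp.toLp 2 fun i => A i x

/-- `S_p`, the set of minimizers of `f + g ∘ A`. -/
def solSet (f : X → EReal) (g : Fin m → ℝ → EReal) (A : Fin m → X →L[ℝ] ℝ) : Set X :=
  argminOn (fun x => f x + directSum g (stack A x)) Set.univ

/-- The qualification condition `0 ∈ sri (dom g - A (dom f))`. -/
def Qualification (f : X → EReal) (g : Fin m → ℝ → EReal) (A : Fin m → X →L[ℝ] ℝ) : Prop :=
  (0 : EuclideanSpace ℝ (Fin m)) ∈
    sri {z | ∃ y ∈ effDom (directSum g), ∃ x ∈ effDom f, z = y - stack A x}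

end Problem

/-! ### The product space `X^{m+1}` -/

/-- The Hilbert space `X^{m+1}`; the coordinate `i` of the first `m` is `i.castSucc`, and the
last coordinate is `Fin.last m`. -/
abbrev ProdSpace (X : Type*) [NormedAddCommGroup X] [InnerProductSpace ℝ X] (m : ℕ) : Type _ :=
  PiLp 2 fun _ : Fin (m + 1) => X

section Product

variable {X : Type*} [NormedAddCommGroup X] [InnerProductSpace ℝ X] {m : ℕ}

/-- The vector `(u₁, …, uₘ, v)`. -/
def tuple (u : Fin m → X) (v : X) : ProdSpace X m :=
  WithLp.toLp 2 (Fin.snoc (α := fun _ => X) u v)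

/-- The average `x̄` of the coordinates. -/
def avg (x : ProdSpace X m) : X := (1 / ((m : ℝ) + 1)) • ∑ j, x j

/-- `H (x⁽¹⁾, …, x⁽ᵐ⁺¹⁾) = ∑ i, g i (A i x⁽ⁱ⁾) + f x⁽ᵐ⁺¹⁾`. -/
def sumFn (f : X → EReal) (g : Fin m → ℝ → EReal) (A : Fin m → X →L[ℝ] ℝ)
    (x : ProdSpace X m) : EReal :=
  (∑ i : Fin m, g i (A i (x i.castSucc))) + f (x (Fin.last m))

variable (X m) in
/-- The diagonal subspace `D`. -/
def diagonal : Submodule ℝ (ProdSpace X m) where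
  carrier := {x | ∀ i j, x i = x j}
  zero_mem' := fun _ _ => rfl
  add_mem' := fun {x y} hx hy i j => by simp [hx i j, hy i j]
  smul_mem' := fun c x hx i j => by simp [hx i j]

theorem isClosed_diagonal : IsClosed (diagonal X m : Set (ProdSpace X m)) := by
  have h : (diagonal X m : Set (ProdSpace X m)) = ⋂ i, ⋂ j, {x : ProdSpace X m | x i = x j} := by
    ext x
    simp only [Set.mem_iInter]
    exact Iff.rfl
  rw [h]
  exact isClosed_iInter fun i => isClosed_iInter fun j =>
    isClosed_eq (by fun_prop) (by fun_prop)

instance [CompleteSpace X] : CompleteSpace (diagonal X m) :=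
  isClosed_diagonal.completeSpace_coe

variable (X m) in
/-- `Ξ = Q ∘ P_D`, where `P_D` is the metric projection onto `D` and `Q` is the first
coordinate. -/
def Xi [CompleteSpace X] : ProdSpace X m →L[ℝ] X :=
  (PiLp.proj 2 (fun _ : Fin (m + 1) => X) 0 : ProdSpace X m →L[ℝ] X) ∘L (diagonal X m).starProjection

/-- The positive number `a a^*` for a functional `a` (an operator on `ℝ` is a number). -/
def sqGain [CompleteSpace X] (a : X →L[ℝ] ℝ) : ℝ := a (ContinuousLinearMap.adjoint a 1)

/-- `x + (a a^*)⁻¹ a^* (prox_{(a a^*) φ} (a x) - a x)`. -/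
def proxStep [CompleteSpace X] (φ : ℝ → EReal) (a : X →L[ℝ] ℝ) (x : X) : X :=
  x + (sqGain a)⁻¹ •
    ContinuousLinearMap.adjoint a (prox (fun t => (sqGain a : EReal) * φ t) (a x) - a x)

/-- The operator `T_DRS_II` by its explicit formula. -/
def drsII [CompleteSpace X] (f : X → EReal) (g : Fin m → ℝ → EReal) (A : Fin m → X →L[ℝ] ℝ)
    (x : ProdSpace X m) : ProdSpace X m :=
  tuple
    (fun i => ((2 : ℝ) • avg x - x i.castSucc) +
      (2 : ℝ) • (sqGain (A i))⁻¹ • ContinuousLinearMap.adjoint (A i)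
        (prox (fun t => (sqGain (A i) : EReal) * g i t) (A i ((2 : ℝ) • avg x - x i.castSucc))
          - A i ((2 : ℝ) • avg x - x i.castSucc)))
    ((2 : ℝ) • prox f ((2 : ℝ) • avg x - x (Fin.last m)) - ((2 : ℝ) • avg x - x (Fin.last m)))

/-- `x`, `xh`, `xs` are the sequences `X_n`, `X_{n+1/2}` (at index `n`) and `x^⋆_n` of the
algorithm; the value `xs 0` plays no role. -/
structure IsIteration (T : ProdSpace X m → ProdSpace X m) (gradΨ : X → X) (α : ℝ) (lam : ℕ → ℝ)
    (x xh : ℕ → ProdSpace X m) (xs : ℕ → X) : Prop where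
  half : ∀ n, xh n = (1 - α) • x n + α • T (x n)
  star : ∀ n, xs (n + 1) = (1 / ((m : ℝ) + 1)) • ∑ j, xh n j
  next : ∀ n i, x (n + 1) i = xh n i - (lam (n + 1) / ((m : ℝ) + 1)) • gradΨ (xs (n + 1))

end Product

end HSDM

end

/-! For a function in Γ₀, p is the proximal point of x exactly when x - p is a subgradient at p
(`IsGammaZero.mem_proxSet_iff`). Monotonicity of subgradients makes the reflection 2 prox - I
nonexpansive; composing it with the isometry 2 P_D - I gives nonexpansiveness of `drsII`.

The same criterion describes the fixed points: x is fixed iff P_D x - x is a subgradient of H at P_D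
x. This vector is orthogonal to D, so P_D x minimizes H over D, where H is a copy of f + g ∘ A.
Conversely, a solution x₀ needs a subgradient of H at (x₀, …, x₀) orthogonal to D. It is B^* w,
where B x = (A_i x⁽ⁱ⁾ - A_i x⁽ᵐ⁺¹⁾)_i vanishes on D and w is the Fenchel multiplier that the
qualification condition provides (`exists_multiplier`).

For the convergence, T_α pulls distant points towards a fixed point by a fixed amount when Fix T is
bounded (`exists_norm_relax_sub_le`); this outweighs the vanishing gradient steps, so the orbit is
bounded. On a ball, compactness makes strict inequalities uniform. The distance to Fix T therefore
tends to 0; after that, the squared distance to argmin Θ over Fix T drops by a multiple of λ as long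
as it is not small, and ∑ λ = ∞ forces it to 0. Both limits come from `tendsto_zero_of_decrease`.
Finally Ξ is Lipschitz and maps these minimizers onto Ω. -/

namespace HSDM

/-! ### Subgradients and proximity operators -/

section Convex

variable {E : Type*} [NormedAddCommGroup E] [InnerProductSpace ℝ E] {F G : E → EReal}

theorem IsGammaZero.exists_real (hF : IsGammaZero F) {x : E} (hx : F x < ⊤) :
    ∃ a : ℝ, F x = a :=
  ⟨(F x).toReal, (EReal.coe_toReal hx.ne (hF.ne_bot x)).symm⟩

theorem IsGammaZero.convex_real (hF : IsGammaZero F) {x y : E} {a b t : ℝ} (hx : F x = a)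
    (hy : F y = b) (ht : 0 < t) (ht' : t < 1) :
    ∃ c : ℝ, F (t • x + (1 - t) • y) = c ∧ c ≤ t * a + (1 - t) * b := by
  have h := hF.convex x (by simp [effDom, hx]) y (by simp [effDom, hy]) t ht ht'
  rw [hx, hy] at h
  have h' : F (t • x + (1 - t) • y) ≤ ((t * a + (1 - t) * b : ℝ) : EReal) := by
    push_cast at h ⊢; exact h
  obtain ⟨c, hc⟩ := hF.exists_real (h'.trans_lt (EReal.coe_lt_top _))
  exact ⟨c, hc, by rw [hc] at h'; exact_mod_cast h'⟩

/-- `F` is finite at `p` and `v` is a subgradient of `F` at `p`. -/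
def IsSubgradientAt (F : E → EReal) (v p : E) : Prop :=
  ∃ a : ℝ, F p = a ∧ ∀ y, ((a + inner ℝ v (y - p) : ℝ) : EReal) ≤ F y

theorem IsSubgradientAt.inner_sub_nonneg {u v p q : E} (hp : IsSubgradientAt F u p)
    (hq : IsSubgradientAt F v q) : 0 ≤ inner ℝ (u - v) (p - q) := by
  obtain ⟨a, ha, h1⟩ := hp
  obtain ⟨b, hb, h2⟩ := hq
  have h1 := h1 q
  have h2 := h2 p
  rw [hb, EReal.coe_le_coe_iff] at h1
  rw [ha, EReal.coe_le_coe_iff] at h2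
  have h3 : inner ℝ (u - v) (p - q) = -inner ℝ u (q - p) - inner ℝ v (p - q) := by
    rw [← inner_neg_right, neg_sub, inner_sub_left]
  linarith

/-- Completing the square: ½‖y - x‖² exceeds ½‖p - x‖² - ⟨x - p, y - p⟩ by ½‖y - p‖² ≥ 0, which is
all the subgradient inequality has to be combined with. -/
theorem IsSubgradientAt.mem_proxSet {x p : E} (hp : IsSubgradientAt F (x - p) p) :
    p ∈ proxSet F x := by
  obtain ⟨a, ha, h⟩ := hp
  refine ⟨Set.mem_univ _, fun y _ => ?_⟩
  have h1 : a + 1 / 2 * ‖p - x‖ ^ 2 ≤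
      a + inner ℝ (x - p) (y - p) + 1 / 2 * ‖y - x‖ ^ 2 := by
    have h2 : y - x = (y - p) - (x - p) := by abel
    have h3 : p - x = -(x - p) := by abel
    rw [h2, h3, norm_neg, norm_sub_sq_real (y - p), real_inner_comm (x - p) (y - p)]
    nlinarith [sq_nonneg ‖y - p‖]
  change F p + _ ≤ F y + _
  rw [ha, ← EReal.coe_add]
  calc ((a + 1 / 2 * ‖p - x‖ ^ 2 : ℝ) : EReal)
      ≤ ((a + inner ℝ (x - p) (y - p) + 1 / 2 * ‖y - x‖ ^ 2 : ℝ) : EReal) := by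
        exact_mod_cast h1
    _ ≤ _ := by
        rw [EReal.coe_add]
        gcongr
        exact h y

/-- Compare p with t y + (1 - t) p, bound F there by convexity, divide by t and let t tend to 0. -/
theorem IsGammaZero.isSubgradientAt_of_mem_proxSet (hF : IsGammaZero F) {x p : E}
    (hp : p ∈ proxSet F x) : IsSubgradientAt F (x - p) p := by
  have hp' : ∀ y, F p + ((1 / 2 * ‖p - x‖ ^ 2 : ℝ) : EReal) ≤
    F y + ((1 / 2 * ‖y - x‖ ^ 2 : ℝ) : EReal) := fun y => hp.2 y (Set.mem_univ _)
  obtain ⟨x₀, hx₀⟩ := hF.proper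
  obtain ⟨a₀, ha₀⟩ := hF.exists_real hx₀
  have hpt : F p < ⊤ := by
    by_contra hcon
    have h := hp' x₀
    rw [not_lt_top_iff.1 hcon, ha₀, EReal.top_add_coe, ← EReal.coe_add] at h
    exact absurd h (not_le.2 (EReal.coe_lt_top _))
  obtain ⟨a, ha⟩ := hF.exists_real hpt
  refine ⟨a, ha, fun y => ?_⟩
  rcases eq_or_ne (F y) ⊤ with hy | hy
  · rw [hy]; exact le_top
  obtain ⟨b, hb⟩ := hF.exists_real (lt_top_iff_ne_top.2 hy)
  rw [hb, EReal.coe_le_coe_iff]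
  have key : ∀ t : ℝ, t ∈ Set.Ioo (0 : ℝ) 1 →
      0 ≤ b - a - inner ℝ (x - p) (y - p) + t * (1 / 2 * ‖y - p‖ ^ 2) := by
    intro t ht
    obtain ⟨c, hc, hc'⟩ := hF.convex_real hb ha ht.1 ht.2
    have h := hp' (t • y + (1 - t) • p)
    rw [hc, ha, ← EReal.coe_add, ← EReal.coe_add, EReal.coe_le_coe_iff] at h
    have e1 : t • y + (1 - t) • p - x = t • (y - p) - (x - p) := by module
    have e2 : p - x = -(x - p) := by abel
    have e3 := norm_sub_sq_real (t • (y - p)) (x - p)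
    rw [norm_smul, real_inner_smul_left, real_inner_comm, mul_pow, Real.norm_eq_abs,
      sq_abs] at e3
    rw [e1, e2, norm_neg, e3] at h
    have h5 : 0 ≤ t * (b - a - inner ℝ (x - p) (y - p) + t * (1 / 2 * ‖y - p‖ ^ 2)) := by
      nlinarith
    exact nonneg_of_mul_nonneg_right h5 ht.1
  have hlim : Tendsto (fun t : ℝ => b - a - inner ℝ (x - p) (y - p) + t * (1 / 2 * ‖y - p‖ ^ 2))
      (𝓝[>] 0) (𝓝 (b - a - inner ℝ (x - p) (y - p) + 0 * (1 / 2 * ‖y - p‖ ^ 2))) :=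
    (Continuous.tendsto (by fun_prop) 0).mono_left nhdsWithin_le_nhds
  have := ge_of_tendsto hlim (by
    filter_upwards [Ioo_mem_nhdsGT (zero_lt_one (α := ℝ))] with t ht using key t ht)
  linarith

theorem IsGammaZero.mem_proxSet_iff (hF : IsGammaZero F) {x p : E} :
    p ∈ proxSet F x ↔ IsSubgradientAt F (x - p) p :=
  ⟨hF.isSubgradientAt_of_mem_proxSet, IsSubgradientAt.mem_proxSet⟩

/-- Firm nonexpansiveness of the proximity operator, in implicit form. -/
theorem IsGammaZero.norm_sq_le_inner (hF : IsGammaZero F) {x y p q : E} (hp : p ∈ proxSet F x)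
    (hq : q ∈ proxSet F y) : ‖p - q‖ ^ 2 ≤ inner ℝ (x - y) (p - q) := by
  have h := (hF.mem_proxSet_iff.1 hp).inner_sub_nonneg (hF.mem_proxSet_iff.1 hq)
  have e : x - p - (y - q) = (x - y) - (p - q) := by abel
  rw [e, inner_sub_left, real_inner_self_eq_norm_sq] at h
  linarith

theorem IsGammaZero.eq_of_mem_proxSet (hF : IsGammaZero F) {x p q : E} (hp : p ∈ proxSet F x)
    (hq : q ∈ proxSet F x) : p = q := by
  have h := hF.norm_sq_le_inner hp hq
  rw [sub_self, inner_zero_left] at h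
  exact sub_eq_zero.1 (norm_eq_zero.1 (pow_eq_zero_iff two_ne_zero |>.1
    (le_antisymm h (sq_nonneg _))))

/-- A function in `Γ₀` decreases at most linearly. -/
theorem IsGammaZero.exists_lower_bound (hF : IsGammaZero F) :
    ∃ (x₀ : E) (c k : ℝ), 0 ≤ k ∧ ∀ (y : E) (b : ℝ), F y = b → c - k * ‖y - x₀‖ ≤ b := by
  obtain ⟨x₀, hx₀⟩ := hF.proper
  obtain ⟨a, ha⟩ := hF.exists_real hx₀
  have h1 : ((a - 1 : ℝ) : EReal) < F x₀ := by
    rw [ha]; exact_mod_cast sub_one_lt a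
  obtain ⟨r, hr, hball⟩ := Metric.eventually_nhds_iff.1 (hF.lsc x₀ _ h1)
  refine ⟨x₀, a - 1, 2 / r, by positivity, fun y b hb => ?_⟩
  by_cases hy : dist y x₀ < r
  · have : ((a - 1 : ℝ) : EReal) < F y := hball hy
    rw [hb, EReal.coe_lt_coe_iff] at this
    have h3 : 0 ≤ 2 / r * ‖y - x₀‖ := by positivity
    linarith
  · rw [dist_eq_norm, not_lt] at hy
    have hd : 0 < ‖y - x₀‖ := hr.trans_le hy
    set d := ‖y - x₀‖ with hd_def
    -- This weight puts the convex combination of y and x₀ at distance r / 2 from x₀, inside the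
    -- ball where F exceeds a - 1.
    have ht : 0 < r / (2 * d) := by positivity
    have ht' : r / (2 * d) < 1 := by
      rw [div_lt_one (by positivity)]; linarith
    obtain ⟨c, hc, hc'⟩ := hF.convex_real hb ha ht ht'
    have hin : dist ((r / (2 * d)) • y + (1 - r / (2 * d)) • x₀) x₀ < r := by
      have e : (r / (2 * d)) • y + (1 - r / (2 * d)) • x₀ - x₀ = (r / (2 * d)) • (y - x₀) := by
        module
      rw [dist_eq_norm, e, norm_smul, Real.norm_of_nonneg ht.le, ← hd_def]
      have : r / (2 * d) * d = r / 2 := by field_simp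
      rw [this]; linarith
    have h4 : ((a - 1 : ℝ) : EReal) < F ((r / (2 * d)) • y + (1 - r / (2 * d)) • x₀) := hball hin
    rw [hc, EReal.coe_lt_coe_iff] at h4
    have h5 : -1 < r / (2 * d) * (b - a) := by linarith
    have h6 : 2 / r * d * (r / (2 * d)) = 1 := by field_simp
    have h7 : 0 < 2 / r * d := by positivity
    have h8 := mul_lt_mul_of_pos_left h5 h7
    rw [← mul_assoc, h6] at h8
    linarith

/-- Strong convexity of the quadratic term makes every minimizing sequence Cauchy, by the
parallelogram law at midpoints; lower semicontinuity then makes its limit a minimizer. -/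
theorem IsGammaZero.proxSet_nonempty [CompleteSpace E] (hF : IsGammaZero F) (x : E) :
    (proxSet F x).Nonempty := by
  obtain ⟨x₀, c, k, hk, hlow⟩ := hF.exists_lower_bound
  set V : Set ℝ := {r | ∃ (y : E) (a : ℝ), F y = a ∧ r = a + 1 / 2 * ‖y - x‖ ^ 2} with hV
  have hne : V.Nonempty := by
    obtain ⟨z, hz⟩ := hF.proper
    obtain ⟨a, ha⟩ := hF.exists_real hz
    exact ⟨_, z, a, ha, rfl⟩
  have hbdd : BddBelow V := by
    -- The quadratic s² / 2 - k s is at least -k² / 2, so it absorbs the linear decrease of F.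
    refine ⟨c - k * ‖x - x₀‖ - k ^ 2 / 2, ?_⟩
    rintro r ⟨y, a, ha, rfl⟩
    have h1 := hlow y a ha
    have h2 : ‖y - x₀‖ ≤ ‖y - x‖ + ‖x - x₀‖ := norm_sub_le_norm_sub_add_norm_sub _ _ _
    nlinarith [sq_nonneg (‖y - x‖ - k), mul_le_mul_of_nonneg_left h2 hk]
  have hI : ∀ y a, F y = (a : ℝ) → sInf V ≤ a + 1 / 2 * ‖y - x‖ ^ 2 :=
    fun y a ha => csInf_le hbdd ⟨y, a, ha, rfl⟩
  have hex : ∀ n : ℕ, ∃ (y : E) (a : ℝ), F y = a ∧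
      a + 1 / 2 * ‖y - x‖ ^ 2 < sInf V + 1 / ((n : ℝ) + 1) := by
    intro n
    obtain ⟨r, ⟨y, a, ha, rfl⟩, hr⟩ := exists_lt_of_csInf_lt hne
      (lt_add_of_pos_right (sInf V) (Nat.one_div_pos_of_nat (α := ℝ) (n := n)))
    exact ⟨y, a, ha, hr⟩
  choose u a hu hua using hex
  have hdist : ∀ n l, ‖u n - u l‖ ^ 2 ≤ 4 * (1 / ((n : ℝ) + 1) + 1 / ((l : ℝ) + 1)) := by
    intro n l
    obtain ⟨e, he, he'⟩ := hF.convex_real (hu n) (hu l) (t := 1 / 2) (by norm_num) (by norm_num)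
    have h1 := hI _ _ he
    have e1 : (1 / 2 : ℝ) • u n + (1 - 1 / 2 : ℝ) • u l - x =
        (1 / 2 : ℝ) • ((u n - x) + (u l - x)) := by module
    have e2 : u n - u l = (u n - x) - (u l - x) := by abel
    have hp := parallelogram_law_with_norm ℝ (u n - x) (u l - x)
    rw [e1, norm_smul, mul_pow] at h1
    rw [e2]
    have e3 : ‖(1 / 2 : ℝ)‖ ^ 2 = 1 / 4 := by norm_num
    rw [e3] at h1
    nlinarith [hua n, hua l]
  have hcau : CauchySeq u := by
    rw [Metric.cauchySeq_iff']
    intro ε hε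
    obtain ⟨N, hN⟩ := exists_nat_one_div_lt (show 0 < ε ^ 2 / 8 by positivity)
    refine ⟨N, fun n hn => ?_⟩
    rw [dist_eq_norm]
    have h1 := hdist n N
    have h2 : 1 / ((n : ℝ) + 1) ≤ 1 / ((N : ℝ) + 1) :=
      Nat.one_div_le_one_div hn
    exact lt_of_pow_lt_pow_left₀ 2 hε.le (by linarith)
  obtain ⟨p, hp⟩ := cauchySeq_tendsto_of_complete hcau
  have hFp : F p ≤ ((sInf V - 1 / 2 * ‖p - x‖ ^ 2 : ℝ) : EReal) := by
    by_contra hcon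
    rw [not_le] at hcon
    obtain ⟨e, he1, he2⟩ := EReal.lt_iff_exists_real_btwn.1 hcon
    rw [EReal.coe_lt_coe_iff] at he1
    have hev := hp.eventually (hF.lsc p _ he2)
    have hlim : Tendsto (fun n : ℕ => sInf V + 1 / ((n : ℝ) + 1) - 1 / 2 * ‖u n - x‖ ^ 2) atTop
        (𝓝 (sInf V + 0 - 1 / 2 * ‖p - x‖ ^ 2)) :=
      (tendsto_const_nhds.add tendsto_one_div_add_atTop_nhds_zero_nat).sub
        (((hp.sub_const x).norm.pow 2).const_mul _)
    rw [add_zero] at hlim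
    obtain ⟨n, hn1, hn2⟩ := (hev.and (hlim.eventually (gt_mem_nhds he1))).exists
    rw [hu n, gt_iff_lt, EReal.coe_lt_coe_iff] at hn1
    linarith [hua n]
  obtain ⟨b, hb⟩ := hF.exists_real (hFp.trans_lt (EReal.coe_lt_top _))
  refine ⟨p, Set.mem_univ _, fun y _ => ?_⟩
  change F p + _ ≤ F y + _
  rcases eq_or_ne (F y) ⊤ with hy | hy
  · rw [hy, EReal.top_add_coe]; exact le_top
  obtain ⟨d, hd⟩ := hF.exists_real (lt_top_iff_ne_top.2 hy)
  rw [hb, EReal.coe_le_coe_iff] at hFp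
  have := hI y d hd
  rw [hb, hd, ← EReal.coe_add, ← EReal.coe_add, EReal.coe_le_coe_iff]
  linarith

theorem IsGammaZero.prox_mem [CompleteSpace E] (hF : IsGammaZero F) (x : E) :
    prox F x ∈ proxSet F x :=
  Classical.epsilon_spec (p := fun p => p ∈ proxSet F x) (hF.proxSet_nonempty x)

theorem IsGammaZero.proxSet_eq (hF : IsGammaZero F) {x p : E} (hp : p ∈ proxSet F x) :
    proxSet F x = {p} :=
  Set.eq_singleton_iff_unique_mem.2 ⟨hp, fun _ hq => hF.eq_of_mem_proxSet hq hp⟩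

theorem IsGammaZero.prox_eq [CompleteSpace E] (hF : IsGammaZero F) {x p : E}
    (hp : p ∈ proxSet F x) : prox F x = p :=
  hF.eq_of_mem_proxSet (hF.prox_mem x) hp

/-- The reflected proximity operator is nonexpansive. -/
theorem IsGammaZero.norm_reflect_sub_le [CompleteSpace E] (hF : IsGammaZero F) (x y : E) :
    ‖((2 : ℝ) • prox F x - x) - ((2 : ℝ) • prox F y - y)‖ ≤ ‖x - y‖ := by
  have h := hF.norm_sq_le_inner (hF.prox_mem x) (hF.prox_mem y)
  have e : ((2 : ℝ) • prox F x - x) - ((2 : ℝ) • prox F y - y) =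
      (2 : ℝ) • (prox F x - prox F y) - (x - y) := by module
  refine (sq_le_sq₀ (norm_nonneg _) (norm_nonneg _)).1 ?_
  rw [e, norm_sub_sq_real, norm_smul, inner_smul_left, real_inner_comm, mul_pow]
  norm_num
  linarith

end Convex

/-! ### Operations preserving Γ₀ -/

section Calculus

variable {E E' : Type*} [NormedAddCommGroup E] [InnerProductSpace ℝ E] [NormedAddCommGroup E']
  [InnerProductSpace ℝ E'] {F G : E → EReal}

theorem isGammaZero_of_real (hbot : ∀ x, F x ≠ ⊥) (hdom : (effDom F).Nonempty)
    (hlsc : LowerSemicontinuous F)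
    (hconv : ∀ (x y : E) (a b t : ℝ), F x = a → F y = b → 0 < t → t < 1 →
      F (t • x + (1 - t) • y) ≤ ((t * a + (1 - t) * b : ℝ) : EReal)) : IsGammaZero F := by
  refine ⟨hbot, hdom, hlsc, fun x hx y hy t ht ht' => ?_⟩
  have ha := EReal.coe_toReal (ne_of_lt hx) (hbot x)
  have hb := EReal.coe_toReal (ne_of_lt hy) (hbot y)
  have := hconv x y _ _ t ha.symm hb.symm ht ht'
  rw [← ha, ← hb]
  push_cast at this ⊢
  exact this

theorem IsGammaZero.comp {F : E' → EReal} (hF : IsGammaZero F) (L : E →L[ℝ] E')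
    (hL : ∃ x, F (L x) < ⊤) : IsGammaZero fun x => F (L x) :=
  isGammaZero_of_real (fun _ => hF.ne_bot _) hL
    (fun x c hc => L.continuous.continuousAt.eventually (hF.lsc (L x) c hc))
    fun x y a b t ha hb ht ht' => by
      obtain ⟨c, hc, hc'⟩ := hF.convex_real ha hb ht ht'
      simp only [map_add, map_smul]
      rw [hc]
      exact_mod_cast hc'

theorem IsGammaZero.add (hF : IsGammaZero F) (hG : IsGammaZero G)
    (h : ∃ x, F x < ⊤ ∧ G x < ⊤) : IsGammaZero fun x => F x + G x := by
  refine isGammaZero_of_real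
    (fun x => EReal.add_ne_bot_iff.2 ⟨hF.ne_bot x, hG.ne_bot x⟩)
    (h.imp fun x hx => EReal.add_lt_top hx.1.ne hx.2.ne)
    -- Addition on `EReal` is discontinuous only at opposite infinities, which cannot occur as
    -- neither value is `⊥`.
    (hF.lsc.add' hG.lsc fun x => EReal.continuousAt_add (.inr (hG.ne_bot x)) (.inl (hF.ne_bot x)))
    fun x y a b t ha hb ht ht' => ?_
  have hsplit : ∀ (z : E) (c : ℝ), F z + G z = c → ∃ c₁ c₂ : ℝ, F z = c₁ ∧ G z = c₂ ∧ c₁ + c₂ = c := by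
    intro z c hz
    have h1 : F z ≠ ⊤ := fun h => by
      rw [h, EReal.top_add_of_ne_bot (hG.ne_bot z)] at hz; exact EReal.coe_ne_top _ hz.symm
    have h2 : G z ≠ ⊤ := fun h => by
      rw [h, EReal.add_top_of_ne_bot (hF.ne_bot z)] at hz; exact EReal.coe_ne_top _ hz.symm
    obtain ⟨c₁, h1⟩ := hF.exists_real (lt_top_iff_ne_top.2 h1)
    obtain ⟨c₂, h2⟩ := hG.exists_real (lt_top_iff_ne_top.2 h2)
    rw [h1, h2] at hz
    exact ⟨c₁, c₂, h1, h2, by exact_mod_cast hz⟩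
  obtain ⟨a₁, a₂, ha₁, ha₂, rfl⟩ := hsplit x a ha
  obtain ⟨b₁, b₂, hb₁, hb₂, rfl⟩ := hsplit y b hb
  obtain ⟨c, hc, hc'⟩ := hF.convex_real ha₁ hb₁ ht ht'
  obtain ⟨d, hd, hd'⟩ := hG.convex_real ha₂ hb₂ ht ht'
  rw [hc, hd, ← EReal.coe_add, EReal.coe_le_coe_iff]
  linarith

theorem isGammaZero_zero : IsGammaZero fun _ : E => (0 : EReal) :=
  isGammaZero_of_real (fun _ => EReal.zero_ne_bot) ⟨0, EReal.zero_lt_top⟩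
    lowerSemicontinuous_const fun x y a b t ha hb _ _ => by
      have ha : a = 0 := by exact_mod_cast ha.symm
      have hb : b = 0 := by exact_mod_cast hb.symm
      simp [ha, hb]

theorem ereal_sum_lt_top {ι : Type*} {s : Finset ι} {φ : ι → EReal} (h : ∀ i ∈ s, φ i < ⊤) :
    ∑ i ∈ s, φ i < ⊤ := by
  classical
  induction s using Finset.induction_on with
  | empty => simp
  | insert i s hi ih =>
    rw [Finset.sum_insert hi]
    exact EReal.add_lt_top (h i (Finset.mem_insert_self i s)).ne
      (ih fun j hj => h j (Finset.mem_insert_of_mem hj)).ne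

theorem IsGammaZero.sum {ι : Type*} {φ : ι → E → EReal} (s : Finset ι)
    (hφ : ∀ i ∈ s, IsGammaZero (φ i)) (h : ∃ x, ∀ i ∈ s, φ i x < ⊤) :
    IsGammaZero fun x => ∑ i ∈ s, φ i x := by
  classical
  obtain ⟨x, hx⟩ := h
  induction s using Finset.induction_on with
  | empty => simpa using isGammaZero_zero
  | insert i s hi ih =>
    simp only [Finset.sum_insert hi]
    refine (hφ i (Finset.mem_insert_self i s)).add
      (ih (fun j hj => hφ j (Finset.mem_insert_of_mem hj))
        fun j hj => hx j (Finset.mem_insert_of_mem hj))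
      ⟨x, hx i (Finset.mem_insert_self i s),
        ereal_sum_lt_top fun j hj => hx j (Finset.mem_insert_of_mem hj)⟩

theorem ereal_coe_mul_ne_bot {c : ℝ} (hc : 0 < c) {e : EReal} (he : e ≠ ⊥) : (c : EReal) * e ≠ ⊥ := by
  induction e with
  | bot => exact absurd rfl he
  | coe r => rw [← EReal.coe_mul]; exact EReal.coe_ne_bot _
  | top => rw [EReal.coe_mul_top_of_pos hc]; exact top_ne_bot

theorem IsGammaZero.const_mul (hF : IsGammaZero F) {c : ℝ} (hc : 0 < c) :
    IsGammaZero fun x => (c : EReal) * F x := by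
  have hc0 : (c : EReal) ≠ 0 := by exact_mod_cast hc.ne'
  refine isGammaZero_of_real (fun x => ereal_coe_mul_ne_bot hc (hF.ne_bot x)) ?_ ?_ ?_
  · obtain ⟨x, hx⟩ := hF.proper
    obtain ⟨a, ha⟩ := hF.exists_real hx
    exact ⟨x, by simp only [effDom, Set.mem_ofPred_eq, ha, ← EReal.coe_mul, EReal.coe_lt_top]⟩
  · refine Continuous.comp_lowerSemicontinuous (g := fun e : EReal => (c : EReal) * e) ?_ hF.lsc
      fun x y h => mul_le_mul_of_nonneg_left h (by exact_mod_cast hc.le)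
    refine continuous_iff_continuousAt.2 fun e => ?_
    exact (EReal.continuousAt_mul (p := ((c : EReal), e)) (.inl hc0) (.inl hc0)
      (.inl (EReal.coe_ne_bot c)) (.inl (EReal.coe_ne_top c))).comp
      (f := fun e : EReal => ((c : EReal), e)) (by fun_prop)
  · intro x y a b t ha hb ht ht'
    have hdiv : ∀ (z : E) (d : ℝ), (c : EReal) * F z = d → ∃ d' : ℝ, F z = d' ∧ d = c * d' := by
      intro z d hz
      have h1 : F z ≠ ⊤ := fun h => by
        rw [h, EReal.coe_mul_top_of_pos hc] at hz; exact EReal.coe_ne_top _ hz.symm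
      obtain ⟨d', h1⟩ := hF.exists_real (lt_top_iff_ne_top.2 h1)
      rw [h1] at hz
      exact ⟨d', h1, by exact_mod_cast hz.symm⟩
    obtain ⟨a', ha', rfl⟩ := hdiv x a ha
    obtain ⟨b', hb', rfl⟩ := hdiv y b hb
    obtain ⟨d, hd, hd'⟩ := hF.convex_real ha' hb' ht ht'
    simp only [hd, ← EReal.coe_mul, EReal.coe_le_coe_iff]
    nlinarith [mul_le_mul_of_nonneg_left hd' hc.le]

end Calculus

/-! ### Composition with a nonzero functional -/

section Functional

variable {X : Type*} [NormedAddCommGroup X] [InnerProductSpace ℝ X]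

theorem exists_apply_eq_of_ne_zero {a : X →L[ℝ] ℝ} (ha : a ≠ 0) (t : ℝ) : ∃ x, a x = t := by
  obtain ⟨x, hx⟩ : ∃ x, a x ≠ 0 := by
    by_contra! h
    exact ha (ContinuousLinearMap.ext h)
  exact ⟨(t / a x) • x, by simp [hx]⟩

theorem IsGammaZero.comp_functional {φ : ℝ → EReal} (hφ : IsGammaZero φ) {a : X →L[ℝ] ℝ}
    (ha : a ≠ 0) : IsGammaZero fun z => φ (a z) := by
  obtain ⟨t, ht⟩ := hφ.proper
  obtain ⟨x, rfl⟩ := exists_apply_eq_of_ne_zero ha t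
  exact hφ.comp a ⟨x, ht⟩

variable [CompleteSpace X]

theorem sqGain_eq_norm_sq (a : X →L[ℝ] ℝ) :
    sqGain a = ‖ContinuousLinearMap.adjoint a 1‖ ^ 2 := by
  rw [← real_inner_self_eq_norm_sq, ContinuousLinearMap.adjoint_inner_left]
  simp [sqGain]

theorem sqGain_pos {a : X →L[ℝ] ℝ} (ha : a ≠ 0) : 0 < sqGain a := by
  rw [sqGain_eq_norm_sq]
  have h : ContinuousLinearMap.adjoint a 1 ≠ 0 := by
    intro h
    refine ha (ContinuousLinearMap.ext fun x => ?_)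
    have := ContinuousLinearMap.adjoint_inner_left a x 1
    rw [h, inner_zero_left] at this
    simpa using this.symm
  positivity

theorem apply_adjoint_eq (a : X →L[ℝ] ℝ) (t : ℝ) :
    a (ContinuousLinearMap.adjoint a t) = sqGain a * t := by
  have : t = t • (1 : ℝ) := by simp
  conv_lhs => rw [this, map_smul, map_smul, smul_eq_mul, mul_comm]
  rfl

/-- Write γ = a a^* and q for the prox of γ φ at a u. The step p satisfies a p = q and u - p = γ⁻¹
a^*(a u - q). Since a u - q is a subgradient of γ φ at q, dividing by γ and pulling back by a^*
makes u - p a subgradient of φ ∘ a at p. -/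
theorem proxStep_mem_proxSet {φ : ℝ → EReal} (hφ : IsGammaZero φ) {a : X →L[ℝ] ℝ}
    (ha : a ≠ 0) (u : X) : proxStep φ a u ∈ proxSet (fun z => φ (a z)) u := by
  have hγ := sqGain_pos ha
  have hγφ := hφ.const_mul hγ
  obtain ⟨b, hb, hsub⟩ := hγφ.isSubgradientAt_of_mem_proxSet (hγφ.prox_mem (a u))
  set q := prox (fun t => (sqGain a : EReal) * φ t) (a u) with hq
  have hap : a (proxStep φ a u) = q := by
    rw [proxStep, map_add, map_smul, apply_adjoint_eq, ← hq, smul_eq_mul, ← mul_assoc,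
      inv_mul_cancel₀ hγ.ne']
    ring
  have hqt : φ q ≠ ⊤ := fun h => by
    simp only [h, EReal.coe_mul_top_of_pos hγ] at hb
    exact EReal.coe_ne_top _ hb.symm
  obtain ⟨d, hd⟩ := hφ.exists_real (lt_top_iff_ne_top.2 hqt)
  have hbd : sqGain a * d = b := by
    simp only [hd] at hb
    exact_mod_cast hb
  refine IsSubgradientAt.mem_proxSet ⟨d, by simp only [hap, hd], fun y => ?_⟩
  rcases eq_or_ne (φ (a y)) ⊤ with hy | hy
  · simp only [hy, le_top]
  obtain ⟨e, he⟩ := hφ.exists_real (lt_top_iff_ne_top.2 hy)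
  have h1 := hsub (a y)
  simp only [he] at h1
  rw [← EReal.coe_mul, EReal.coe_le_coe_iff] at h1
  simp only [he, EReal.coe_le_coe_iff]
  have e1 : u - proxStep φ a u = -((sqGain a)⁻¹ • ContinuousLinearMap.adjoint a (q - a u)) := by
    rw [proxStep, ← hq]; abel
  have e2 : inner ℝ (u - proxStep φ a u) (y - proxStep φ a u) =
      (sqGain a)⁻¹ * ((a u - q) * (a y - q)) := by
    rw [e1, inner_neg_left, real_inner_smul_left, ContinuousLinearMap.adjoint_inner_left, map_sub,
      hap]
    simp only [RCLike.inner_apply, conj_trivial]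
    ring
  rw [e2]
  simp only [RCLike.inner_apply, conj_trivial] at h1
  have h2 := mul_le_mul_of_nonneg_left h1 (inv_nonneg.2 hγ.le)
  rw [← hbd, mul_add, ← mul_assoc, ← mul_assoc, inv_mul_cancel₀ hγ.ne',
    inv_mul_cancel_left₀ hγ.ne'] at h2
  linarith

end Functional

/-! ### The product space and the reflections defining T -/

section Product

variable {X : Type*} [NormedAddCommGroup X] [InnerProductSpace ℝ X] {m : ℕ}

@[simp]
theorem tuple_castSucc (u : Fin m → X) (v : X) (i : Fin m) : tuple u v i.castSucc = u i := by
  simp [tuple]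

@[simp]
theorem tuple_last (u : Fin m → X) (v : X) : tuple u v (Fin.last m) = v := by
  simp [tuple]

theorem prodSpace_ext {x y : ProdSpace X m} (h : ∀ i : Fin m, x i.castSucc = y i.castSucc)
    (h' : x (Fin.last m) = y (Fin.last m)) : x = y := by
  ext j
  induction j using Fin.lastCases with
  | last => exact h'
  | cast i => exact h i

theorem prodSpace_inner (x y : ProdSpace X m) : inner ℝ x y =
    (∑ i : Fin m, inner ℝ (x i.castSucc) (y i.castSucc)) +
      inner ℝ (x (Fin.last m)) (y (Fin.last m)) := by
  rw [PiLp.inner_apply, Fin.sum_univ_castSucc]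

/-- The constant vector `(v, …, v)`. -/
def constVec (m : ℕ) (v : X) : ProdSpace X m := WithLp.toLp 2 fun _ => v

@[simp]
theorem constVec_apply (v : X) (j : Fin (m + 1)) : constVec m v j = v := rfl

theorem constVec_mem_diagonal (v : X) : constVec m v ∈ diagonal X m := fun _ _ => rfl

theorem eq_constVec_of_mem_diagonal {x : ProdSpace X m} (hx : x ∈ diagonal X m) :
    x = constVec m (x 0) := by
  ext j
  exact hx j 0

theorem sum_eq_smul_avg (x : ProdSpace X m) : ∑ j, x j = ((m : ℝ) + 1) • avg x := by
  have : (m : ℝ) + 1 ≠ 0 := by positivity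
  rw [avg, smul_smul, mul_one_div_cancel this, one_smul]

theorem inner_constVec_right (x : ProdSpace X m) (v : X) :
    inner ℝ x (constVec m v) = ((m : ℝ) + 1) * inner ℝ (avg x) v := by
  rw [PiLp.inner_apply]
  simp only [constVec_apply]
  rw [← sum_inner, sum_eq_smul_avg, real_inner_smul_left]

theorem avg_constVec (v : X) : avg (constVec m v) = v := by
  have : (m : ℝ) + 1 ≠ 0 := by positivity
  simp only [avg, constVec_apply, Finset.sum_const, Finset.card_univ, Fintype.card_fin]
  rw [← Nat.cast_smul_eq_nsmul ℝ, smul_smul]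
  push_cast
  rw [one_div_mul_cancel this, one_smul]

theorem avg_sub (x y : ProdSpace X m) : avg (x - y) = avg x - avg y := by
  simp [avg, smul_sub]

variable {f : X → EReal} {g : Fin m → ℝ → EReal} {A : Fin m → X →L[ℝ] ℝ}

/-- Properness needs no qualification: the coordinates are independent and a nonzero functional is
onto ℝ, so each summand can be made finite separately. -/
theorem isGammaZero_sumFn (hf : IsGammaZero f) (hg : ∀ i, IsGammaZero (g i))
    (hA : ∀ i, A i ≠ 0) : IsGammaZero (sumFn f g A) := by
  choose t ht using fun i => (hg i).proper
  choose u hu using fun i => exists_apply_eq_of_ne_zero (hA i) (t i)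
  obtain ⟨v, hv : f v < ⊤⟩ := hf.proper
  have hgu : ∀ i, g i (A i (u i)) < ⊤ := fun i => by rw [hu]; exact ht i
  let pr : Fin (m + 1) → ProdSpace X m →L[ℝ] X := fun j => PiLp.proj 2 (fun _ => X) j
  have h1 : IsGammaZero fun x : ProdSpace X m => ∑ i : Fin m, g i (A i (x i.castSucc)) :=
    IsGammaZero.sum Finset.univ
      (φ := fun (i : Fin m) (x : ProdSpace X m) => g i (A i (x i.castSucc)))
      (fun i _ => (hg i).comp (A i ∘L pr i.castSucc)
        ⟨tuple u v, by simpa [pr] using hgu i⟩) ⟨tuple u v, fun i _ => by simpa using hgu i⟩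
  have h2 : IsGammaZero fun x : ProdSpace X m => f (x (Fin.last m)) :=
    hf.comp (pr (Fin.last m)) ⟨tuple u v, by simpa [pr] using hv⟩
  exact h1.add h2 ⟨tuple u v, ereal_sum_lt_top fun i _ => by simpa using hgu i, by simpa using hv⟩

variable [CompleteSpace X]

theorem starProjection_diagonal (x : ProdSpace X m) :
    (diagonal X m).starProjection x = constVec m (avg x) := by
  refine Submodule.eq_starProjection_of_mem_of_inner_eq_zero (constVec_mem_diagonal _)
    fun w hw => ?_
  rw [eq_constVec_of_mem_diagonal hw, inner_constVec_right, avg_sub, avg_constVec, sub_self,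
    inner_zero_left, mul_zero]

theorem Xi_apply (x : ProdSpace X m) : Xi X m x = avg x := by
  simp [Xi, starProjection_diagonal]

theorem adjoint_Xi_apply (v : X) :
    ContinuousLinearMap.adjoint (Xi X m) v = constVec m ((1 / ((m : ℝ) + 1)) • v) := by
  have : (m : ℝ) + 1 ≠ 0 := by positivity
  refine ext_inner_left ℝ fun x => ?_
  rw [ContinuousLinearMap.adjoint_inner_right, Xi_apply, inner_constVec_right,
    real_inner_smul_right, ← mul_assoc, mul_one_div_cancel this, one_mul]

theorem proxSet_indicator_diagonal (x : ProdSpace X m) :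
    proxSet (indicatorFn (diagonal X m : Set (ProdSpace X m))) x =
      {(diagonal X m).starProjection x} := by
  classical
  set p := (diagonal X m).starProjection x with hp
  have hpm : p ∈ diagonal X m := Submodule.starProjection_apply_mem _ x
  have hin : ∀ y ∈ diagonal X m, indicatorFn (diagonal X m : Set (ProdSpace X m)) y = 0 :=
    fun y hy => by simp [indicatorFn, hy]
  have hout : ∀ y ∉ diagonal X m, indicatorFn (diagonal X m : Set (ProdSpace X m)) y = ⊤ :=
    fun y hy => by simp [indicatorFn, hy]
  have hpyth : ∀ y ∈ diagonal X m, ‖y - x‖ ^ 2 = ‖p - x‖ ^ 2 + ‖y - p‖ ^ 2 := by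
    intro y hy
    have h0 : inner ℝ (p - x) (y - p) = 0 := by
      rw [← neg_sub x p, inner_neg_left, hp,
        Submodule.starProjection_inner_eq_zero x _ (Submodule.sub_mem _ hy hpm), neg_zero]
    have e : y - x = (p - x) + (y - p) := by abel
    rw [e, norm_add_sq_real, h0]
    ring
  refine Set.eq_singleton_iff_unique_mem.2 ⟨⟨Set.mem_univ _, fun y _ => ?_⟩, fun q hq => ?_⟩
  · by_cases hy : y ∈ diagonal X m
    · simp only [hin p hpm, hin y hy, zero_add, EReal.coe_le_coe_iff]
      nlinarith [hpyth y hy, sq_nonneg ‖y - p‖]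
    · simp only [hout y hy, EReal.top_add_coe, le_top]
  · have h := hq.2 p (Set.mem_univ _)
    by_cases hqm : q ∈ diagonal X m
    · simp only [hin p hpm, hin q hqm, zero_add, EReal.coe_le_coe_iff] at h
      have h1 : ‖q - p‖ ^ 2 ≤ 0 := by nlinarith [hpyth q hqm]
      exact sub_eq_zero.1 (norm_eq_zero.1 (pow_eq_zero_iff two_ne_zero |>.1
        (le_antisymm h1 (sq_nonneg _))))
    · simp only [hin p hpm, hout q hqm, zero_add, EReal.top_add_coe, top_le_iff] at h
      exact absurd h (EReal.coe_ne_top _)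

theorem ereal_coe_sum {ι : Type*} (s : Finset ι) (φ : ι → ℝ) :
    ((∑ i ∈ s, φ i : ℝ) : EReal) = ∑ i ∈ s, (φ i : EReal) := by
  classical
  induction s using Finset.induction_on with
  | empty => simp
  | insert i s hi ih => rw [Finset.sum_insert hi, Finset.sum_insert hi, EReal.coe_add, ih]

/-- H is separable, so the coordinatewise subgradient inequalities add up to one for H. -/
theorem tuple_prox_mem_proxSet (hf : IsGammaZero f) (hg : ∀ i, IsGammaZero (g i))
    (hA : ∀ i, A i ≠ 0) (x : ProdSpace X m) :
    tuple (fun i => prox (fun z => g i (A i z)) (x i.castSucc)) (prox f (x (Fin.last m))) ∈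
      proxSet (sumFn f g A) x := by
  have hgi := fun i => (hg i).comp_functional (hA i)
  choose b hb hsub using fun i =>
    (hgi i).isSubgradientAt_of_mem_proxSet ((hgi i).prox_mem (x i.castSucc))
  obtain ⟨c, hc, hfsub⟩ := hf.isSubgradientAt_of_mem_proxSet (hf.prox_mem (x (Fin.last m)))
  refine IsSubgradientAt.mem_proxSet ⟨∑ i, b i + c, ?_, fun y => ?_⟩
  · simp only [sumFn, tuple_castSucc, tuple_last, EReal.coe_add, ereal_coe_sum, hc]
    congr 1
    exact Finset.sum_congr rfl fun i _ => hb i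
  · rw [prodSpace_inner]
    simp only [PiLp.sub_apply, tuple_castSucc, tuple_last]
    rw [add_add_add_comm, ← Finset.sum_add_distrib, EReal.coe_add, ereal_coe_sum]
    exact add_le_add (Finset.sum_le_sum fun i _ => hsub i _) (hfsub _)

theorem prox_sumFn_eq (hf : IsGammaZero f) (hg : ∀ i, IsGammaZero (g i))
    (hA : ∀ i, A i ≠ 0) (x : ProdSpace X m) :
    prox (sumFn f g A) x = tuple (fun i => proxStep (g i) (A i) (x i.castSucc))
      (prox f (x (Fin.last m))) := by
  rw [(isGammaZero_sumFn hf hg hA).prox_eq (tuple_prox_mem_proxSet hf hg hA x)]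
  congr 1
  funext i
  exact ((hg i).comp_functional (hA i)).prox_eq (proxStep_mem_proxSet (hg i) (hA i) _)

theorem drsII_eq (hf : IsGammaZero f) (hg : ∀ i, IsGammaZero (g i))
    (hA : ∀ i, A i ≠ 0) (x : ProdSpace X m) :
    drsII f g A x = (2 : ℝ) • prox (sumFn f g A)
        ((2 : ℝ) • (diagonal X m).starProjection x - x)
      - ((2 : ℝ) • (diagonal X m).starProjection x - x) := by
  rw [prox_sumFn_eq hf hg hA, starProjection_diagonal, drsII]
  refine prodSpace_ext (fun i => ?_) ?_
  · simp only [tuple_castSucc, PiLp.sub_apply, PiLp.smul_apply, constVec_apply, proxStep]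
    module
  · simp only [tuple_last, PiLp.sub_apply, PiLp.smul_apply, constVec_apply]

theorem norm_reflect_starProjection {E : Type*} [NormedAddCommGroup E] [InnerProductSpace ℝ E]
    (K : Submodule ℝ E) [K.HasOrthogonalProjection] (x : E) :
    ‖(2 : ℝ) • K.starProjection x - x‖ = ‖x‖ := by
  have h := K.starProjection_inner_eq_zero x _ (Submodule.starProjection_apply_mem K x)
  rw [inner_sub_left, real_inner_self_eq_norm_sq, real_inner_comm] at h
  refine (sq_eq_sq₀ (norm_nonneg _) (norm_nonneg _)).1 ?_
  rw [norm_sub_sq_real, norm_smul, real_inner_smul_left, real_inner_comm, mul_pow]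
  rw [real_inner_comm] at h
  norm_num
  linarith

theorem lipschitzWith_drsII (hf : IsGammaZero f) (hg : ∀ i, IsGammaZero (g i))
    (hA : ∀ i, A i ≠ 0) : LipschitzWith 1 (drsII f g A) := by
  refine LipschitzWith.of_dist_le_mul fun x y => ?_
  rw [NNReal.coe_one, one_mul, dist_eq_norm, dist_eq_norm, drsII_eq hf hg hA, drsII_eq hf hg hA]
  refine ((isGammaZero_sumFn hf hg hA).norm_reflect_sub_le _ _).trans ?_
  rw [← norm_reflect_starProjection (diagonal X m) (x - y), map_sub]
  refine le_of_eq (congrArg _ ?_)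
  module

end Product

/-- A convex set in `V × ℝ` that contains the origin, has no point below it, and whose projection
absorbs the submodule `W` it lies in is supported at the origin by the graph of a linear form. -/
theorem exists_linear_le_of_convex {V : Type*} [AddCommGroup V] [Module ℝ V] (W : Submodule ℝ V)
    {Q : Set (V × ℝ)} (hQ : Convex ℝ Q) (h0 : (0, 0) ∈ Q) (hpos : ∀ r : ℝ, (0, r) ∈ Q → 0 ≤ r)
    (hW : ∀ q ∈ Q, q.1 ∈ W) (hcore : ∀ z ∈ W, ∃ t : ℝ, 0 < t ∧ ∃ r, (t • z, r) ∈ Q) :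
    ∃ w : V →ₗ[ℝ] ℝ, ∀ q ∈ Q, w q.1 ≤ q.2 := by
  -- Inside W the projection of the cone is the whole space, as the M. Riesz extension theorem
  -- requires.
  set Q' : Set (W × ℝ) := (W.subtype.prodMap LinearMap.id) ⁻¹' Q with hQ'
  have hQ'c : Convex ℝ Q' := hQ.linear_preimage _
  have hpt : (ConvexCone.hull ℝ Q').Pointed := by
    refine (ConvexCone.mem_hull_of_convex hQ'c).2 ⟨1, one_pos, 0, h0, one_smul ℝ _⟩
  -- The form (0, r) ↦ r on the vertical axis; it is nonnegative on the cone because of `hpos`.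
  let φ : (W × ℝ) →ₗ.[ℝ] ℝ :=
    ⟨LinearMap.ker (LinearMap.fst ℝ W ℝ), (LinearMap.snd ℝ W ℝ).domRestrict _⟩
  obtain ⟨G, hG1, hG2⟩ := riesz_extension ((ConvexCone.hull ℝ Q').toPointedCone hpt) φ
    (by
      rintro ⟨⟨z, r⟩, hz⟩ hzr
      obtain rfl : z = 0 := hz
      obtain ⟨c, hc, ⟨⟨z', r'⟩, hx, hx'⟩⟩ := (ConvexCone.mem_hull_of_convex hQ'c).1 hzr
      simp only [Prod.smul_mk, Prod.mk.injEq, smul_eq_zero, hc.ne', false_or, smul_eq_mul] at hx'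
      obtain ⟨rfl, rfl⟩ := hx'
      exact mul_nonneg hc.le (hpos r' hx))
    (by
      rintro ⟨z, s⟩
      obtain ⟨t, ht, r, hr⟩ := hcore z z.2
      -- Adding this vertical vector to (z, s) gives t⁻¹ (t z, r), a point of the cone.
      refine ⟨⟨(0, t⁻¹ * r - s), rfl⟩, ?_⟩
      refine (ConvexCone.mem_hull_of_convex hQ'c).2 ⟨t⁻¹, inv_pos.2 ht, (t • z, r), hr, ?_⟩
      simp [smul_smul, inv_mul_cancel₀ ht.ne'])
  -- On Q, 0 ≤ G(z, r) = G(z, 0) + r, so -G(·, 0) is the required form on W; any linear extension to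
  -- V will do.
  obtain ⟨w, hw⟩ := LinearMap.exists_extend (-(G.comp (LinearMap.inl ℝ W ℝ)))
  refine ⟨w, fun q hq => ?_⟩
  have h1 : 0 ≤ G (⟨q.1, hW q hq⟩, q.2) :=
    hG2 _ ((ConvexCone.mem_hull_of_convex hQ'c).2 ⟨1, one_pos, _, hq, one_smul ℝ _⟩)
  have h2 : G (0, q.2) = q.2 := hG1 ⟨(0, q.2), rfl⟩
  have h3 : ((⟨q.1, hW q hq⟩, q.2) : W × ℝ) = (⟨q.1, hW q hq⟩, 0) + (0, q.2) := by simp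
  have h4 : w q.1 = -G (⟨q.1, hW q hq⟩, 0) := by
    have := LinearMap.congr_fun hw ⟨q.1, hW q hq⟩
    simpa using this
  rw [h3, map_add, h2] at h1
  linarith

/-! ### Fenchel duality and the fixed points of T -/

section Duality

variable {X : Type*} [NormedAddCommGroup X] [InnerProductSpace ℝ X] {m : ℕ}
  {f : X → EReal} {g : Fin m → ℝ → EReal} {A : Fin m → X →L[ℝ] ℝ}

theorem isGammaZero_directSum (hg : ∀ i, IsGammaZero (g i)) : IsGammaZero (directSum g) := by
  choose t ht using fun i => (hg i).proper
  exact IsGammaZero.sum Finset.univ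
    (φ := fun (i : Fin m) (y : EuclideanSpace ℝ (Fin m)) => g i (y i))
    (fun i _ => (hg i).comp (PiLp.proj 2 (fun _ => ℝ) i : EuclideanSpace ℝ (Fin m) →L[ℝ] ℝ)
      ⟨WithLp.toLp 2 t, ht i⟩) ⟨WithLp.toLp 2 t, fun i _ => ht i⟩

theorem stack_add_smul (x y : X) (s t : ℝ) :
    stack A (s • x + t • y) = s • stack A x + t • stack A y := by
  ext i
  simp [stack]

/-- Membership of 0 in dom g - A dom f supplies a feasible point, so the minimum is finite. -/
theorem exists_real_of_mem_solSet (hf : IsGammaZero f) (hg : ∀ i, IsGammaZero (g i))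
    (hq : Qualification f g A) {x₀ : X} (hx₀ : x₀ ∈ solSet f g A) :
    ∃ a b : ℝ, f x₀ = a ∧ directSum g (stack A x₀) = b := by
  have hG := isGammaZero_directSum hg
  obtain ⟨⟨y, hy, x, hx, hyx⟩, -⟩ := hq
  obtain rfl : y = stack A x := sub_eq_zero.1 hyx.symm
  have h : f x₀ + directSum g (stack A x₀) < ⊤ :=
    (hx₀.2 x (Set.mem_univ _)).trans_lt (EReal.add_lt_top (ne_of_lt hx) (ne_of_lt hy))
  have h1 : f x₀ ≠ ⊤ := fun h1 => by
    rw [h1, EReal.top_add_of_ne_bot (hG.ne_bot _)] at h; exact lt_irrefl _ h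
  have h2 : directSum g (stack A x₀) ≠ ⊤ := fun h2 => by
    rw [h2, EReal.add_top_of_ne_bot (hf.ne_bot _)] at h; exact lt_irrefl _ h
  obtain ⟨a, ha⟩ := hf.exists_real (lt_top_iff_ne_top.2 h1)
  obtain ⟨b, hb⟩ := hG.exists_real (lt_top_iff_ne_top.2 h2)
  exact ⟨a, b, ha, hb⟩

/-- Fenchel duality: a multiplier for the constraint `y = A x`. -/
theorem exists_multiplier (hf : IsGammaZero f) (hg : ∀ i, IsGammaZero (g i))
    (hq : Qualification f g A) {x₀ : X} (hx₀ : x₀ ∈ solSet f g A) {a₀ b₀ : ℝ} (ha₀ : f x₀ = a₀)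
    (hb₀ : directSum g (stack A x₀) = b₀) :
    ∃ w : EuclideanSpace ℝ (Fin m) →ₗ[ℝ] ℝ, ∀ (x : X) (y : EuclideanSpace ℝ (Fin m)) (a b : ℝ),
      f x = a → directSum g y = b → w (y - stack A x) ≤ a + b - (a₀ + b₀) := by
  have hG := isGammaZero_directSum hg
  obtain ⟨-, hcone⟩ := hq
  set C : Set (EuclideanSpace ℝ (Fin m)) :=
    {z | ∃ y ∈ effDom (directSum g), ∃ x ∈ effDom f, z = y - stack A x} with hC
  simp only [sub_zero, Set.image_id'] at hcone
  -- The perturbations y - A x with the attainable excesses over the minimum. Optimality of x₀ says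
  -- that no point lies below the origin; the qualification condition says that the projection of Q
  -- absorbs the closed span.
  let Q : Set (EuclideanSpace ℝ (Fin m) × ℝ) := {q | ∃ (x : X) (y : EuclideanSpace ℝ (Fin m))
    (a b : ℝ), f x = a ∧ directSum g y = b ∧ q.1 = y - stack A x ∧ a + b - (a₀ + b₀) ≤ q.2}
  have hmemC : ∀ {x : X} {y : EuclideanSpace ℝ (Fin m)} {a b : ℝ}, f x = a → directSum g y = b →
      y - stack A x ∈ C := fun {x y a b} ha hb =>
    ⟨y, by rw [effDom, Set.mem_ofPred_eq, hb]; exact EReal.coe_lt_top _, x,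
      by rw [effDom, Set.mem_ofPred_eq, ha]; exact EReal.coe_lt_top _, rfl⟩
  obtain ⟨w, hw⟩ := exists_linear_le_of_convex (Submodule.span ℝ C).topologicalClosure (Q := Q)
    (by
      rintro ⟨_, r⟩ ⟨x, y, a, b, ha, hb, rfl, hr⟩ ⟨_, r'⟩ ⟨x', y', a', b', ha', hb', rfl, hr'⟩
        s t hs ht hst
      -- Convexity in Γ₀ is stated for weights strictly between 0 and 1, so the endpoints are
      -- treated apart.
      rcases hs.eq_or_lt with rfl | hs
      · obtain rfl : t = 1 := by linarith
        simp only [zero_smul, one_smul, zero_add]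
        exact ⟨x', y', a', b', ha', hb', rfl, hr'⟩
      rcases ht.eq_or_lt with rfl | ht
      · obtain rfl : s = 1 := by linarith
        simp only [zero_smul, one_smul, add_zero]
        exact ⟨x, y, a, b, ha, hb, rfl, hr⟩
      obtain rfl : t = 1 - s := by linarith
      obtain ⟨c, hc, hc'⟩ := hf.convex_real ha ha' hs (by linarith)
      obtain ⟨d, hd, hd'⟩ := hG.convex_real hb hb' hs (by linarith)
      refine ⟨_, _, c, d, hc, hd, ?_, ?_⟩
      · simp only [Prod.smul_mk, Prod.mk_add_mk, stack_add_smul]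
        module
      · simp only [Prod.smul_mk, Prod.mk_add_mk, smul_eq_mul]
        nlinarith [mul_le_mul_of_nonneg_left hr hs.le, mul_le_mul_of_nonneg_left hr' ht.le])
    ⟨x₀, _, a₀, b₀, ha₀, hb₀, by simp, by simp⟩
    (by
      rintro r ⟨x, y, a, b, ha, hb, hyx, hr⟩
      obtain rfl : y = stack A x := sub_eq_zero.1 hyx.symm
      have h := hx₀.2 x (Set.mem_univ _)
      simp only [ha₀, hb₀, ha, hb, ← EReal.coe_add, EReal.coe_le_coe_iff] at h
      linarith)
    (by
      rintro ⟨_, r⟩ ⟨x, y, a, b, ha, hb, rfl, hr⟩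
      exact Submodule.le_topologicalClosure _ (Submodule.subset_span (hmemC ha hb)))
    (by
      intro z hz
      have hz' : z ∈ conicalHull C := by rw [hcone]; exact hz
      obtain ⟨t, ht, _, ⟨y, hy, x, hx, rfl⟩, rfl⟩ := hz'
      obtain ⟨a, ha⟩ := hf.exists_real hx
      obtain ⟨b, hb⟩ := hG.exists_real hy
      refine ⟨t⁻¹, inv_pos.2 ht, a + b - (a₀ + b₀), x, y, a, b, ha, hb, ?_, le_rfl⟩
      rw [smul_smul, inv_mul_cancel₀ ht.ne', one_smul])
  exact ⟨w, fun x y a b ha hb => hw (_, _) ⟨x, y, a, b, ha, hb, rfl, le_rfl⟩⟩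

variable [CompleteSpace X]

/-- Take v = B^* w with w the multiplier. B vanishes on the diagonal, so v is orthogonal to it, that
is, has average 0; the multiplier inequality at x = y⁽ᵐ⁺¹⁾ is the subgradient inequality. -/
theorem exists_isSubgradientAt_sumFn (hf : IsGammaZero f) (hg : ∀ i, IsGammaZero (g i))
    (hq : Qualification f g A) {x₀ : X} (hx₀ : x₀ ∈ solSet f g A) :
    ∃ v : ProdSpace X m, avg v = 0 ∧ IsSubgradientAt (sumFn f g A) v (constVec m x₀) := by
  have hG := isGammaZero_directSum hg
  obtain ⟨a₀, b₀, ha₀, hb₀⟩ := exists_real_of_mem_solSet hf hg hq hx₀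
  obtain ⟨w, hw⟩ := exists_multiplier hf hg hq hx₀ ha₀ hb₀
  let pr : Fin (m + 1) → ProdSpace X m →L[ℝ] X := fun j => PiLp.proj 2 (fun _ => X) j
  let B : ProdSpace X m →L[ℝ] EuclideanSpace ℝ (Fin m) :=
    (EuclideanSpace.equiv (Fin m) ℝ).symm.toContinuousLinearMap ∘L
      ContinuousLinearMap.pi fun i : Fin m => A i ∘L (pr i.castSucc - pr (Fin.last m))
  have hB : ∀ x : ProdSpace X m,
      B x = WithLp.toLp 2 (fun i : Fin m => A i (x i.castSucc)) - stack A (x (Fin.last m)) := by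
    intro x
    ext i
    simp [B, pr, stack]
  have hBc : ∀ u : X, B (constVec m u) = 0 := fun u => by
    rw [hB]; exact sub_self _
  let v : ProdSpace X m := (InnerProductSpace.toDual ℝ (ProdSpace X m)).symm
    (LinearMap.toContinuousLinearMap w ∘L B)
  have hv : ∀ x : ProdSpace X m, inner ℝ v x = w (B x) := fun x => by
    rw [InnerProductSpace.toDual_symm_apply]; rfl
  refine ⟨v, ?_, b₀ + a₀, ?_, fun y => ?_⟩
  · refine inner_self_eq_zero (𝕜 := ℝ).1 ?_
    have h := inner_constVec_right v (avg v)
    rw [hv, hBc, map_zero] at h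
    exact (mul_eq_zero.1 h.symm).resolve_left (by positivity)
  · rw [EReal.coe_add, ← ha₀, ← hb₀]
    rfl
  · change _ ≤ directSum g (WithLp.toLp 2 fun i : Fin m => A i (y i.castSucc)) + f (y (Fin.last m))
    rw [inner_sub_right, hv, hv, hBc, map_zero, sub_zero, hB]
    set y' : EuclideanSpace ℝ (Fin m) := WithLp.toLp 2 fun i : Fin m => A i (y i.castSucc)
    rcases eq_or_ne (f (y (Fin.last m))) ⊤ with h1 | h1
    · rw [h1, EReal.add_top_of_ne_bot (hG.ne_bot _)]; exact le_top
    rcases eq_or_ne (directSum g y') ⊤ with h2 | h2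
    · rw [h2, EReal.top_add_of_ne_bot (hf.ne_bot _)]; exact le_top
    obtain ⟨a, ha⟩ := hf.exists_real (lt_top_iff_ne_top.2 h1)
    obtain ⟨b, hb⟩ := hG.exists_real (lt_top_iff_ne_top.2 h2)
    rw [ha, hb, ← EReal.coe_add, EReal.coe_le_coe_iff]
    linarith [hw _ _ a b ha hb]

/-- With p = P_D x, T x = x says 2 prox_H(2p - x) = 2p, and (2p - x) - p = p - x. -/
theorem mem_fixedPoints_drsII_iff (hf : IsGammaZero f) (hg : ∀ i, IsGammaZero (g i))
    (hA : ∀ i, A i ≠ 0) (x : ProdSpace X m) : x ∈ fixedPoints (drsII f g A) ↔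
      IsSubgradientAt (sumFn f g A) (constVec m (avg x) - x) (constVec m (avg x)) := by
  have hH := isGammaZero_sumFn hf hg hA
  set p := constVec m (avg x) with hp
  have e1 : p - x = ((2 : ℝ) • p - x) - p := by module
  rw [mem_fixedPoints, IsFixedPt, drsII_eq hf hg hA, starProjection_diagonal, ← hp, e1,
    ← hH.mem_proxSet_iff]
  constructor
  · intro h
    have h2 : prox (sumFn f g A) ((2 : ℝ) • p - x) = p := by
      refine smul_right_injective _ (two_ne_zero (α := ℝ)) ?_
      have := sub_eq_iff_eq_add.1 h
      simp only [this]
      abel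
    have h3 := hH.prox_mem ((2 : ℝ) • p - x)
    rwa [h2] at h3
  · intro h
    rw [hH.prox_eq h]
    abel

theorem solSet_eq_image (hf : IsGammaZero f) (hg : ∀ i, IsGammaZero (g i))
    (hA : ∀ i, A i ≠ 0) (hq : Qualification f g A) :
    solSet f g A = Xi X m '' fixedPoints (drsII f g A) := by
  ext x₀
  constructor
  · intro hx₀
    obtain ⟨v, hv, hsub⟩ := exists_isSubgradientAt_sumFn hf hg hq hx₀
    have havg : avg (constVec m x₀ - v) = x₀ := by rw [avg_sub, avg_constVec, hv, sub_zero]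
    refine ⟨constVec m x₀ - v, ?_, by rw [Xi_apply, havg]⟩
    rw [mem_fixedPoints_drsII_iff hf hg hA, havg, sub_sub_cancel]
    exact hsub
  · rintro ⟨x, hx, rfl⟩
    rw [mem_fixedPoints_drsII_iff hf hg hA] at hx
    obtain ⟨a, ha, h⟩ := hx
    rw [Xi_apply]
    refine ⟨Set.mem_univ _, fun y _ => ?_⟩
    have h1 := h (constVec m y)
    -- The subgradient is orthogonal to D, so its linear term disappears at competitors on D.
    have h2 : inner ℝ (constVec m (avg x) - x) (constVec m y - constVec m (avg x)) = 0 := by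
      rw [inner_sub_right, inner_constVec_right, inner_constVec_right, avg_sub, avg_constVec,
        sub_self, inner_zero_left, inner_zero_left, sub_self]
    rw [h2, add_zero, ← ha] at h1
    simp only [add_comm (f _)]
    exact h1

end Duality

/-! ### Relaxed nonexpansive operators -/

section Relaxation

theorem norm_sub_le_of_lipschitzWith_one {E : Type*} [NormedAddCommGroup E] {T : E → E}
    (hT : LipschitzWith 1 T) (x y : E) :
    ‖T x - T y‖ ≤ ‖x - y‖ := by
  simpa [dist_eq_norm] using hT.dist_le_mul x y

theorem infDist_le_of_quasi_nonexpansive {E : Type*} [NormedAddCommGroup E] {U : E → E} {S : Set E} (hS : S.Nonempty) {x : E}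
    (h : ∀ z ∈ S, ‖U x - z‖ ≤ ‖x - z‖) : Metric.infDist (U x) S ≤ Metric.infDist x S := by
  refine (Metric.le_infDist hS).2 fun z hz => (Metric.infDist_le_dist_of_mem hz).trans ?_
  rw [dist_eq_norm, dist_eq_norm]
  exact h z hz

variable {E : Type*} [NormedAddCommGroup E] [InnerProductSpace ℝ E] {T : E → E} {α : ℝ}

theorem fixedPoints_relax (hα : 0 < α) : fixedPoints (relax α T) = fixedPoints T := by
  ext x
  have e : relax α T x - x = α • (T x - x) := by rw [relax]; module
  rw [mem_fixedPoints, mem_fixedPoints, IsFixedPt, IsFixedPt, ← sub_eq_zero, e,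
    smul_eq_zero_iff_right hα.ne', sub_eq_zero]

theorem lipschitzWith_relax (hT : LipschitzWith 1 T) (hα : 0 < α) (hα' : α < 1) :
    LipschitzWith 1 (relax α T) := by
  refine LipschitzWith.of_dist_le_mul fun x y => ?_
  rw [NNReal.coe_one, one_mul, dist_eq_norm, dist_eq_norm]
  have e : relax α T x - relax α T y = (1 - α) • (x - y) + α • (T x - T y) := by
    simp only [relax]; module
  rw [e]
  refine (norm_add_le _ _).trans ?_
  rw [norm_smul, norm_smul, Real.norm_of_nonneg hα.le, Real.norm_of_nonneg (by linarith)]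
  nlinarith [norm_sub_le_of_lipschitzWith_one hT x y]

/-- Expanding the square, nonexpansiveness of T leaves a gain of α (1 - α) ‖x - T x‖². -/
theorem norm_relax_sub_lt (hT : LipschitzWith 1 T) (hα : 0 < α) (hα' : α < 1) {x z : E}
    (hx : x ∉ fixedPoints T) (hz : z ∈ fixedPoints T) : ‖relax α T x - z‖ < ‖x - z‖ := by
  have e : relax α T x - z = (x - z) - α • (x - T x) := by rw [relax]; module
  have hb : T x - z = (x - z) - (x - T x) := by abel
  have h1 : ‖T x - z‖ ≤ ‖x - z‖ := by
    have := norm_sub_le_of_lipschitzWith_one hT x z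
    rwa [mem_fixedPoints.1 hz] at this
  have h2 : 0 < ‖x - T x‖ ^ 2 := by
    have : x - T x ≠ 0 := fun h => hx (sub_eq_zero.1 h).symm
    positivity
  have h3 := pow_le_pow_left₀ (norm_nonneg _) h1 2
  rw [hb, norm_sub_sq_real] at h3
  refine lt_of_pow_lt_pow_left₀ 2 (norm_nonneg _) ?_
  rw [e, norm_sub_sq_real, real_inner_smul_right, norm_smul, Real.norm_of_nonneg hα.le, mul_pow]
  nlinarith [mul_pos hα (mul_pos (sub_pos.2 hα') h2)]

theorem isAttractingNonexpansive_relax (hT : LipschitzWith 1 T) (hα : 0 < α) (hα' : α < 1)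
    (hfix : (fixedPoints T).Nonempty) : IsAttractingNonexpansive (relax α T) := by
  refine ⟨lipschitzWith_relax hT hα hα', by rwa [fixedPoints_relax hα], fun x hx z hz => ?_⟩
  rw [fixedPoints_relax hα] at hx hz
  exact norm_relax_sub_lt hT hα hα' hx hz

/-- Far from a bounded fixed point set, a relaxed nonexpansive operator decreases the distance to
a fixed point by at least a constant. -/
theorem exists_norm_relax_sub_le [ProperSpace E] (hT : LipschitzWith 1 T) (hα : 0 < α)
    (hα' : α < 1) (hbdd : Bornology.IsBounded (fixedPoints T)) {z : E} (hz : z ∈ fixedPoints T) :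
    ∃ R c : ℝ, 0 < c ∧ ∀ x, R ≤ ‖x - z‖ → ‖relax α T x - z‖ ≤ ‖x - z‖ - c := by
  obtain ⟨R, hR, hRK⟩ := hbdd.subset_ball_lt 0 z
  -- All fixed points lie in the open ball, so the residual is bounded away from 0 on the compact
  -- sphere.
  obtain ⟨δ, hδ, hδs⟩ := (isCompact_sphere z R).exists_forall_le'
    (f := fun u => ‖u - T u‖ ^ 2) (a := 0)
    (by have := hT.continuous; fun_prop) (fun u hu => by
      have : u - T u ≠ 0 := fun h => by
        have h1 := hRK (sub_eq_zero.1 h).symm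
        rw [Metric.mem_ball, Metric.mem_sphere.1 hu] at h1
        exact lt_irrefl _ h1
      positivity)
  -- I - T is cocoercive, in particular monotone.
  have hco : ∀ x y, ‖(x - T x) - (y - T y)‖ ^ 2 ≤ 2 * inner ℝ ((x - T x) - (y - T y)) (x - y) := by
    intro x y
    have h := pow_le_pow_left₀ (norm_nonneg _) (norm_sub_le_of_lipschitzWith_one hT x y) 2
    have e : T x - T y = (x - y) - ((x - T x) - (y - T y)) := by abel
    rw [e, norm_sub_sq_real, real_inner_comm] at h
    linarith
  have hz0 : z - T z = 0 := sub_eq_zero.2 (mem_fixedPoints.1 hz).symm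
  refine ⟨R, α * (1 - α) * δ / (2 * R),
    by have := sub_pos.2 hα'; positivity, fun x hx => ?_⟩
  set r := ‖x - z‖ with hr
  have hr0 : 0 < r := hR.trans_le hx
  have hxz := hco x z
  rw [hz0, sub_zero] at hxz
  -- Let u be the point of the sphere on the ray from z through x. The bound holds with the residual
  -- at u, and monotonicity of I - T along the ray carries it to x.
  have hgrow : r * δ / (2 * R) ≤ inner ℝ (x - T x) (x - z) := by
    set u := z + (R / r) • (x - z) with hu
    have hus : u ∈ Metric.sphere z R := by
      rw [Metric.mem_sphere, dist_eq_norm, hu, add_sub_cancel_left, norm_smul,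
        Real.norm_of_nonneg (by positivity), ← hr, div_mul_cancel₀ _ hr0.ne']
    have h1 := hco u z
    rw [hz0, sub_zero] at h1
    have h2 : δ ≤ 2 * inner ℝ (u - T u) (u - z) := (hδs u hus).trans h1
    have e1 : u - z = (R / r) • (x - z) := by rw [hu]; abel
    have e2 : x - u = (1 - R / r) • (x - z) := by rw [hu]; module
    rw [e1, real_inner_smul_right] at h2
    have h3 : r * δ / (2 * R) ≤ inner ℝ (u - T u) (x - z) := by
      rw [div_le_iff₀ (by positivity)]
      have h4 := mul_le_mul_of_nonneg_left h2 hr0.le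
      have h5 : r * (2 * (R / r * inner ℝ (u - T u) (x - z))) =
        inner ℝ (u - T u) (x - z) * (2 * R) := by field_simp
      linarith
    have h6 := hco x u
    rw [e2, real_inner_smul_right, inner_sub_left] at h6
    rcases hx.eq_or_lt with h | h
    · have e3 : u = x := by
        rw [hu, h, div_self hr0.ne']; module
      rwa [e3] at h3
    · have h7 : 0 < 1 - R / r := by
        rw [sub_pos, div_lt_one hr0]; exact h
      have h8 : 0 ≤ (1 - R / r) * (inner ℝ (x - T x) (x - z) - inner ℝ (u - T u) (x - z)) := by
        nlinarith [sq_nonneg ‖x - T x - (u - T u)‖]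
      have h9 := nonneg_of_mul_nonneg_right h8 h7
      linarith
  set c := α * (1 - α) * δ / (2 * R) with hc
  have hc0 : 0 < c := by have := sub_pos.2 hα'; positivity
  have hsq : ‖relax α T x - z‖ ^ 2 ≤ r ^ 2 - 2 * c * r := by
    have e : relax α T x - z = (x - z) - α • (x - T x) := by rw [relax]; module
    rw [e, norm_sub_sq_real, real_inner_smul_right, norm_smul, Real.norm_of_nonneg hα.le, mul_pow,
      real_inner_comm, ← hr]
    have h1 : c * r = α * (1 - α) * (r * δ / (2 * R)) := by rw [hc]; ring
    have h2 := mul_le_mul_of_nonneg_left hgrow (mul_pos hα (sub_pos.2 hα')).le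
    have h3 := mul_le_mul_of_nonneg_left hxz (sq_nonneg α)
    nlinarith
  -- This makes r - c nonnegative, so that r² - 2 c r ≤ (r - c)² can be read without squares.
  have hrc : 2 * c ≤ r := by
    have : 0 ≤ r * (r - 2 * c) := by nlinarith [sq_nonneg ‖relax α T x - z‖]
    linarith [nonneg_of_mul_nonneg_right this hr0]
  refine (sq_le_sq₀ (norm_nonneg _) (by linarith)).1 ?_
  nlinarith [sq_nonneg c]

end Relaxation

/-! ### Real sequences -/

section Sequences

/-- Divergence of ∑ λ forces e below ε / 2 at some late index. From then on e stays below ε: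
starting below ε / 2 it rises by less than ε / 2, and starting above it does not increase. -/
theorem tendsto_zero_of_decrease {e lam μ : ℕ → ℝ} (he : ∀ n, 0 ≤ e n) (hlam : ∀ n, 0 ≤ lam n)
    (hdiv : ¬ Summable lam) (hμ : Tendsto μ atTop (𝓝 0))
    (hstep : ∀ᶠ n in atTop, e (n + 1) ≤ e n + μ n)
    (hdec : ∀ ε > 0, ∃ δ > 0, ∀ᶠ n in atTop, ε ≤ e n → e (n + 1) ≤ e n - δ * lam n) :
    Tendsto e atTop (𝓝 0) := by
  rw [not_summable_iff_tendsto_nat_atTop_of_nonneg hlam] at hdiv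
  refine tendsto_order.2 ⟨fun a ha => Eventually.of_forall fun n => ha.trans_le (he n),
    fun ε hε => ?_⟩
  obtain ⟨δ, hδ, hev⟩ := hdec (ε / 2) (half_pos hε)
  obtain ⟨N, hN⟩ := eventually_atTop.1
    (hev.and (hstep.and (hμ.eventually (gt_mem_nhds (half_pos hε)))))
  obtain ⟨n₀, hn₀, hsmall⟩ : ∃ n ≥ N, e n < ε / 2 := by
    by_contra! hcon
    have hind : ∀ k, e (N + k) + δ * ∑ i ∈ Finset.range (N + k), lam i ≤
        e N + δ * ∑ i ∈ Finset.range N, lam i := by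
      intro k
      induction k with
      | zero => simp
      | succ k ih =>
        have := (hN (N + k) (Nat.le_add_right _ _)).1 (hcon _ (Nat.le_add_right _ _))
        rw [← add_assoc, Finset.sum_range_succ]
        linarith
    have hbig := (hdiv.const_mul_atTop hδ).eventually_gt_atTop
      (e N + δ * ∑ i ∈ Finset.range N, lam i)
    obtain ⟨k, hk⟩ := ((tendsto_add_atTop_nat N).eventually hbig).exists
    have h1 := hind k
    rw [add_comm N k] at h1
    linarith [he (k + N)]
  refine eventually_atTop.2 ⟨n₀, fun n hn => ?_⟩
  induction n, hn using Nat.le_induction with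
  | base => linarith
  | succ n hn ih =>
    obtain ⟨h1, h2, h3⟩ := hN n (hn₀.trans hn)
    rcases lt_or_ge (e n) (ε / 2) with h | h
    · linarith
    · linarith [h1 h, mul_nonneg hδ.le (hlam n)]

theorem exists_bound_of_le_mul {b s : ℕ → ℝ} (hb : ∀ n, 0 ≤ b n) (hs : ∀ n, 0 ≤ s n)
    (hsum : Summable s) (h : ∀ n, b (n + 1) ≤ (1 + s n) * b n) : ∃ C, ∀ n, b n ≤ C := by
  have hind : ∀ n, b n ≤ Real.exp (∑ i ∈ Finset.range n, s i) * b 0 := by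
    intro n
    induction n with
    | zero => simp
    | succ n ih =>
      rw [Finset.sum_range_succ, add_comm (∑ i ∈ _, _), Real.exp_add, mul_assoc]
      refine (h n).trans (mul_le_mul ?_ ih (hb n) (Real.exp_pos _).le)
      linarith [Real.add_one_le_exp (s n)]
  refine ⟨Real.exp (∑' i, s i) * b 0, fun n => (hind n).trans ?_⟩
  gcongr
  · exact hb 0
  · exact hsum.sum_le_tsum _ fun i _ => hs i

end Sequences

/-! ### The hybrid steepest descent method -/

section Descent

variable {E : Type*} [NormedAddCommGroup E] [InnerProductSpace ℝ E] {T : E → E} {α : ℝ}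
  {Θ : E → ℝ} {D : E → E} {κ : NNReal} {lam : ℕ → ℝ} {x : ℕ → E}

/-- Since D is monotone, the cross term has the good sign and I - l D expands distances only to
second order in l, which is summable along the iteration; l ‖D z‖ is the cost of D z ≠ 0. -/
theorem norm_gradient_step_le (hΘ : ∀ x y, Θ x + inner ℝ (D x) (y - x) ≤ Θ y)
    (hD : LipschitzWith κ D) {l : ℝ} (hl : 0 ≤ l) (y z : E) :
    ‖y - l • D y - z‖ ≤ (1 + (κ : ℝ) ^ 2 * l ^ 2) * ‖y - z‖ + l * ‖D z‖ := by
  have hmono : 0 ≤ inner ℝ (D y - D z) (y - z) := by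
    have h1 := hΘ y z
    have h2 := hΘ z y
    rw [← neg_sub y z, inner_neg_right] at h1
    rw [inner_sub_left]
    linarith
  have hLip : ‖D y - D z‖ ≤ κ * ‖y - z‖ := by simpa [dist_eq_norm] using hD.dist_le_mul y z
  have hLip2 : ‖D y - D z‖ ^ 2 ≤ (κ * ‖y - z‖) ^ 2 :=
    pow_le_pow_left₀ (norm_nonneg _) hLip 2
  have h1 : ‖(y - z) - l • (D y - D z)‖ ≤ (1 + (κ : ℝ) ^ 2 * l ^ 2) * ‖y - z‖ := by
    refine (sq_le_sq₀ (norm_nonneg _) (by positivity)).1 ?_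
    rw [norm_sub_sq_real, real_inner_smul_right, norm_smul, Real.norm_of_nonneg hl, mul_pow,
      real_inner_comm]
    have h3 := mul_le_mul_of_nonneg_left hLip2 (sq_nonneg l)
    have h4 := mul_nonneg hl hmono
    have h5 : 0 ≤ (κ : ℝ) ^ 2 * l ^ 2 * ‖y - z‖ ^ 2 := by positivity
    have h6 : 0 ≤ ((κ : ℝ) ^ 2 * l ^ 2 * ‖y - z‖) ^ 2 := by positivity
    nlinarith
  have e : y - l • D y - z = ((y - z) - l • (D y - D z)) - l • D z := by module
  rw [e]
  refine (norm_sub_le _ _).trans ?_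
  rw [norm_smul l, Real.norm_of_nonneg hl]
  linarith

/-- The subgradient inequalities at x and at y squeeze Θ y between two functions tending to Θ x. -/
theorem continuous_of_subgradient (hΘ : ∀ x y, Θ x + inner ℝ (D x) (y - x) ≤ Θ y)
    (hD : Continuous D) : Continuous Θ := by
  refine continuous_iff_continuousAt.2 fun x => ?_
  have h1 : Tendsto (fun y => Θ x + inner ℝ (D x) (y - x)) (𝓝 x) (𝓝 (Θ x)) := by
    have : Continuous fun y => Θ x + inner ℝ (D x) (y - x) := by fun_prop
    simpa using this.tendsto x
  have h2 : Tendsto (fun y => Θ x - inner ℝ (D y) (x - y)) (𝓝 x) (𝓝 (Θ x)) := by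
    have : Continuous fun y => Θ x - inner ℝ (D y) (x - y) := by fun_prop
    simpa using this.tendsto x
  exact tendsto_of_tendsto_of_tendsto_of_le_of_le h1 h2 (fun y => hΘ x y)
    fun y => by linarith [hΘ y x]

theorem tendsto_zero_of_summable_sq (hlam2 : Summable fun n => lam n ^ 2) :
    Tendsto lam atTop (𝓝 0) := by
  have h := hlam2.tendsto_atTop_zero.sqrt
  simp only [Real.sqrt_sq_eq_abs, Real.sqrt_zero] at h
  exact (tendsto_zero_iff_abs_tendsto_zero lam).2 h

variable [ProperSpace E]

theorem exists_bound_descent (hT : LipschitzWith 1 T) (hα : 0 < α) (hα' : α < 1)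
    (hbdd : Bornology.IsBounded (fixedPoints T)) {z : E} (hz : z ∈ fixedPoints T)
    (hΘ : ∀ x y, Θ x + inner ℝ (D x) (y - x) ≤ Θ y) (hD : LipschitzWith κ D)
    (hlam : ∀ n, 0 ≤ lam n) (hlam2 : Summable fun n => lam n ^ 2)
    (hx : ∀ n, x (n + 1) = relax α T (x n) - lam n • D (relax α T (x n))) :
    ∃ C, ∀ᶠ n in atTop, ‖x n - z‖ ≤ C := by
  obtain ⟨R, c, hc, hfar⟩ := exists_norm_relax_sub_le hT hα hα' hbdd hz
  have hlim : Tendsto (fun n => lam n * ‖D z‖) atTop (𝓝 0) := by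
    simpa using (tendsto_zero_of_summable_sq hlam2).mul_const ‖D z‖
  obtain ⟨N, hN⟩ := eventually_atTop.1 (hlim.eventually (ge_mem_nhds hc))
  -- The floor |R| + c ensures ‖T_α x - z‖ ≤ B - c on both sides of radius R; the margin c then pays
  -- for λ ‖D z‖, leaving only the factor 1 + κ² λ².
  obtain ⟨C, hC⟩ := exists_bound_of_le_mul (b := fun k => max ‖x (k + N) - z‖ (|R| + c))
    (s := fun k => (κ : ℝ) ^ 2 * lam (k + N) ^ 2)
    (fun k => (norm_nonneg _).trans (le_max_left _ _)) (fun k => by positivity)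
    (((summable_nat_add_iff N).2 hlam2).mul_left _) (fun k => by
      have hRc : 0 ≤ |R| + c := by positivity
      have hs : 0 ≤ (κ : ℝ) ^ 2 * lam (k + N) ^ 2 := by positivity
      set s := (κ : ℝ) ^ 2 * lam (k + N) ^ 2 with hs_def
      set B := max ‖x (k + N) - z‖ (|R| + c) with hB
      have hB0 : 0 ≤ B := hRc.trans (le_max_right _ _)
      refine max_le ?_ ?_
      · have h1 := norm_gradient_step_le hΘ hD (hlam (k + N)) (relax α T (x (k + N))) z
        rw [← hx, ← hs_def, add_right_comm] at h1
        have h2 := hN (k + N) (Nat.le_add_left _ _)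
        have h3 : ‖relax α T (x (k + N)) - z‖ ≤ B - c := by
          rcases le_total R ‖x (k + N) - z‖ with h | h
          · linarith [hfar _ h, le_max_left ‖x (k + N) - z‖ (|R| + c)]
          · have h4 := norm_sub_le_of_lipschitzWith_one (lipschitzWith_relax hT hα hα') (x (k + N)) z
            have h5 : relax α T z = z := by
              have : z ∈ fixedPoints (relax α T) := by rwa [fixedPoints_relax hα]
              exact this
            rw [h5] at h4
            linarith [le_abs_self R, le_max_right ‖x (k + N) - z‖ (|R| + c)]
        have h6 := mul_le_mul_of_nonneg_left h3 (show 0 ≤ 1 + s by linarith)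
        nlinarith [mul_nonneg hs hc.le]
      · nlinarith [le_max_right ‖x (k + N) - z‖ (|R| + c), mul_nonneg hs hB0])
  refine ⟨C, eventually_atTop.2 ⟨N, fun n hn => ?_⟩⟩
  have := hC (n - N)
  simp only [Nat.sub_add_cancel hn] at this
  exact (le_max_left _ _).trans this

/-- Convergence of the hybrid steepest descent method to the minimizers of a convex function over
a bounded fixed point set in finite dimension. -/
theorem tendsto_infDist_hybrid_steepest_descent (hT : LipschitzWith 1 T) (hα : 0 < α) (hα' : α < 1)
    (hne : (fixedPoints T).Nonempty) (hbdd : Bornology.IsBounded (fixedPoints T))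
    (hΘ : ∀ x y, Θ x + inner ℝ (D x) (y - x) ≤ Θ y) (hD : LipschitzWith κ D)
    (hlam : ∀ n, 0 ≤ lam n) (hlam2 : Summable fun n => lam n ^ 2) (hdiv : ¬ Summable lam)
    (hx : ∀ n, x (n + 1) = relax α T (x n) - lam n • D (relax α T (x n))) :
    Tendsto (fun n => Metric.infDist (relax α T (x n)) (argminOn Θ (fixedPoints T))) atTop
      (𝓝 0) := by
  obtain ⟨z₀, hz₀⟩ := hne
  set K := fixedPoints T with hK
  set U := relax α T with hU
  set S := argminOn Θ K with hS
  have hUlip : LipschitzWith 1 U := lipschitzWith_relax hT hα hα'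
  have hUle : ∀ x, ∀ z ∈ K, ‖U x - z‖ ≤ ‖x - z‖ := by
    intro x z hz
    have h := norm_sub_le_of_lipschitzWith_one hUlip x z
    have h' : z ∈ fixedPoints U := by rw [hU, fixedPoints_relax hα]; exact hz
    rwa [mem_fixedPoints.1 h'] at h
  have hΘc : Continuous Θ := continuous_of_subgradient hΘ hD.continuous
  have hKcl : IsClosed K := isClosed_fixedPoints hT.continuous
  have hKc : IsCompact K := Metric.isCompact_of_isClosed_isBounded hKcl hbdd
  obtain ⟨s₀, hs₀, hmin⟩ := hKc.exists_isMinOn ⟨z₀, hz₀⟩ hΘc.continuousOn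
  have hs₀S : s₀ ∈ S := ⟨hs₀, fun y hy => hmin hy⟩
  have hSeq : S = K ∩ {y | Θ y ≤ Θ s₀} := by
    ext y
    exact ⟨fun hy => ⟨hy.1, hy.2 s₀ hs₀⟩, fun hy => ⟨hy.1, fun w hw => hy.2.trans (hmin hw)⟩⟩
  have hSc : IsCompact S := by
    rw [hSeq]
    exact hKc.inter_right (isClosed_le hΘc continuous_const)
  obtain ⟨C₀, hC₀⟩ := exists_bound_descent hT hα hα' hbdd hz₀ hΘ hD hlam hlam2 hx
  obtain ⟨C₁, hC₁⟩ := hbdd.subset_closedBall z₀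
  set C := max C₀ C₁ with hC
  have hKball : ∀ z ∈ K, ‖z - z₀‖ ≤ C := fun z hz => by
    have := Metric.mem_closedBall.1 (hC₁ hz)
    rw [dist_eq_norm] at this
    exact this.trans (le_max_right _ _)
  have hxball : ∀ᶠ n in atTop, ‖x n - z₀‖ ≤ C := hC₀.mono fun n h => h.trans (le_max_left _ _)
  have hyball : ∀ᶠ n in atTop, ‖U (x n) - z₀‖ ≤ C := hxball.mono fun n h => (hUle _ _ hz₀).trans h
  have hball : IsCompact (Metric.closedBall z₀ C) := isCompact_closedBall z₀ C
  have hmem : ∀ {y : E}, ‖y - z₀‖ ≤ C → y ∈ Metric.closedBall z₀ C := fun {y} h => by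
    rwa [Metric.mem_closedBall, dist_eq_norm]
  obtain ⟨M, hM⟩ := hball.exists_bound_of_continuousOn hD.continuous.continuousOn
  have hM0 : 0 ≤ M := (norm_nonneg _).trans (hM z₀ (hmem (by simpa using hKball z₀ hz₀)))
  have hDy : ∀ᶠ n in atTop, ‖D (U (x n))‖ ≤ M := hyball.mono fun n h => hM _ (hmem h)
  have hlam0 := tendsto_zero_of_summable_sq hlam2
  have hstepK : ∀ᶠ n in atTop,
      Metric.infDist (x (n + 1)) K ≤ Metric.infDist (U (x n)) K + lam n * M := by
    filter_upwards [hDy] with n hn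
    refine (Metric.infDist_le_infDist_add_dist (y := U (x n))).trans ?_
    gcongr
    rw [dist_eq_norm, hx, sub_sub_cancel_left, norm_neg, norm_smul, Real.norm_of_nonneg (hlam n)]
    exact mul_le_mul_of_nonneg_left hn (hlam n)
  have hlamM : Tendsto (fun n => lam n * M) atTop (𝓝 0) := by simpa using hlam0.mul_const M
  have hxK : Tendsto (fun n => Metric.infDist (x n) K) atTop (𝓝 0) := by
    -- The decrease here comes from T_α alone and is uniform in n, hence unit weights; half of δ is
    -- kept to pay for the gradient step.
    refine tendsto_zero_of_decrease (lam := fun _ => 1) (fun n => Metric.infDist_nonneg)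
      (fun _ => zero_le_one) (fun h => by simpa using h.tendsto_atTop_zero) hlamM ?_ ?_
    · filter_upwards [hstepK] with n hn
      linarith [infDist_le_of_quasi_nonexpansive ⟨z₀, hz₀⟩ (hUle (x n))]
    · intro ε hε
      obtain ⟨δ, hδ, hδs⟩ := (hball.inter_right (isClosed_le continuous_const
        (Metric.continuous_infDist_pt K) : IsClosed {y | ε ≤ Metric.infDist y K})).exists_forall_le'
        (f := fun y => Metric.infDist y K - Metric.infDist (U y) K) (a := 0)
        (((Metric.continuous_infDist_pt K).sub
          ((Metric.continuous_infDist_pt K).comp hUlip.continuous)).continuousOn)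
        (fun y hy => by
          obtain ⟨z, hz, hdist⟩ := hKc.exists_infDist_eq_dist ⟨z₀, hz₀⟩ y
          have hyK : y ∉ K := fun h => by
            have h1 : ε ≤ Metric.infDist y K := hy.2
            rw [Metric.infDist_zero_of_mem h] at h1
            linarith
          have h1 := norm_relax_sub_lt hT hα hα' hyK hz
          have h2 := Metric.infDist_le_dist_of_mem (x := U y) hz
          rw [dist_eq_norm] at h2 hdist
          rw [hdist]
          linarith)
      refine ⟨δ / 2, half_pos hδ, ?_⟩
      filter_upwards [hstepK, hxball, hlamM.eventually (ge_mem_nhds (half_pos hδ))]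
        with n h1 h2 h3 h4
      linarith [hδs (x n) ⟨hmem h2, h4⟩]
  have hyK : Tendsto (fun n => Metric.infDist (U (x n)) K) atTop (𝓝 0) :=
    squeeze_zero (fun n => Metric.infDist_nonneg)
      (fun n => infDist_le_of_quasi_nonexpansive ⟨z₀, hz₀⟩ (hUle (x n))) hxK
  have hSne : S.Nonempty := ⟨s₀, hs₀S⟩
  -- z is a nearest point of S to T_α x_n; as z is fixed by T_α, the next application of T_α does
  -- not move away from it.
  have hrec : ∀ᶠ n in atTop, ∃ z ∈ S, Metric.infDist (U (x n)) S = ‖U (x n) - z‖ ∧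
      Metric.infDist (U (x (n + 1))) S ^ 2 ≤ Metric.infDist (U (x n)) S ^ 2 -
        2 * (lam n * inner ℝ (D (U (x n))) (U (x n) - z)) + lam n ^ 2 * M ^ 2 := by
    filter_upwards [hDy] with n hn
    obtain ⟨z, hz, hdist⟩ := hSc.exists_infDist_eq_dist hSne (U (x n))
    rw [dist_eq_norm] at hdist
    refine ⟨z, hz, hdist, ?_⟩
    have h1 : Metric.infDist (U (x (n + 1))) S ≤ ‖x (n + 1) - z‖ := by
      refine (Metric.infDist_le_dist_of_mem hz).trans ?_
      rw [dist_eq_norm]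
      exact hUle _ z hz.1
    have e : x (n + 1) - z = (U (x n) - z) - lam n • D (U (x n)) := by rw [hx]; abel
    have h2 := pow_le_pow_left₀ Metric.infDist_nonneg h1 2
    rw [e, norm_sub_sq_real, real_inner_smul_right, norm_smul, Real.norm_of_nonneg (hlam n),
      mul_pow, real_inner_comm, ← hdist] at h2
    have h3 := mul_le_mul_of_nonneg_left (pow_le_pow_left₀ (norm_nonneg _) hn 2) (sq_nonneg (lam n))
    linarith
  have hsq : Tendsto (fun n => Metric.infDist (U (x n)) S ^ 2) atTop (𝓝 0) := by
    refine tendsto_zero_of_decrease (lam := lam)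
      (μ := fun n => lam n * (4 * M * C) + lam n ^ 2 * M ^ 2) (fun n => sq_nonneg _)
      hlam hdiv ?_ ?_ ?_
    · simpa using (hlam0.mul_const (4 * M * C)).add ((hlam0.pow 2).mul_const (M ^ 2))
    · filter_upwards [hrec, hDy, hyball] with n ⟨z, hz, hdist, h⟩ hn hy
      have h1 : ‖U (x n) - z‖ ≤ 2 * C := by
        have := norm_sub_le_norm_sub_add_norm_sub (U (x n)) z₀ z
        rw [norm_sub_rev z₀ z] at this
        linarith [hKball z hz.1]
      have h2 : -(M * (2 * C)) ≤ inner ℝ (D (U (x n))) (U (x n) - z) := by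
        have h3 := neg_le_of_abs_le (abs_real_inner_le_norm (D (U (x n))) (U (x n) - z))
        have h4 := mul_le_mul hn h1 (norm_nonneg _) hM0
        linarith
      have h5 := mul_le_mul_of_nonneg_left h2 (hlam n)
      linarith
    · intro ε hε
      -- Away from S a point is either off K or has Θ above its minimum on K, uniformly by
      -- compactness. The first alternative is eventually excluded by `hyK`, so Θ exceeds its
      -- minimum by δ.
      obtain ⟨δ, hδ, hδs⟩ := (hball.inter_right (isClosed_le continuous_const
        ((Metric.continuous_infDist_pt S).pow 2) :
          IsClosed {y | ε ≤ Metric.infDist y S ^ 2})).exists_forall_le'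
        (f := fun y => max (Metric.infDist y K) (Θ y - Θ s₀)) (a := 0)
        (((Metric.continuous_infDist_pt K).max (hΘc.sub continuous_const)).continuousOn)
        (fun y hy => by
          by_cases hyK : y ∈ K
          · refine lt_max_of_lt_right (sub_pos.2 ?_)
            by_contra! hle
            have hyS : y ∈ S := by rw [hSeq]; exact ⟨hyK, hle⟩
            have h1 : ε ≤ Metric.infDist y S ^ 2 := hy.2
            rw [Metric.infDist_zero_of_mem hyS] at h1
            linarith
          · exact lt_max_of_lt_left ((hKcl.notMem_iff_infDist_pos ⟨z₀, hz₀⟩).1 hyK))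
      refine ⟨δ, hδ, ?_⟩
      have hlamM2 : Tendsto (fun n => lam n * M ^ 2) atTop (𝓝 0) := by
        simpa using hlam0.mul_const (M ^ 2)
      filter_upwards [hrec, hyball, hyK.eventually (gt_mem_nhds hδ),
        hlamM2.eventually (ge_mem_nhds hδ)] with n ⟨z, hz, hdist, h⟩ hy hK' hl he
      have h1 : δ ≤ Θ (U (x n)) - Θ s₀ :=
        (le_max_iff.1 (hδs (U (x n)) ⟨hmem hy, he⟩)).resolve_left (not_le.2 hK')
      have h2 := hΘ (U (x n)) z
      rw [← neg_sub (U (x n)) z, inner_neg_right] at h2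
      have h3 : δ ≤ inner ℝ (D (U (x n))) (U (x n) - z) := by linarith [hz.2 s₀ hs₀]
      have h4 := mul_le_mul_of_nonneg_left h3 (hlam n)
      have h5 := mul_le_mul_of_nonneg_left hl (hlam n)
      -- The gain 2 λ δ minus the error λ² M² ≤ λ δ leaves λ δ.
      nlinarith
  have := hsq.sqrt
  simpa only [Real.sqrt_sq Metric.infDist_nonneg, Real.sqrt_zero] using this

end Descent

/-! ### Gâteaux gradients and transfer through Ξ -/

section Gradient

variable {E E' : Type*} [NormedAddCommGroup E] [InnerProductSpace ℝ E] [NormedAddCommGroup E']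
  [InnerProductSpace ℝ E']

theorem HasGateauxGradientAt.comp [CompleteSpace E] [CompleteSpace E'] {Ψ : E' → ℝ} {a : E'}
    (L : E →L[ℝ] E') {x : E} (h : HasGateauxGradientAt Ψ a (L x)) :
    HasGateauxGradientAt (fun z => Ψ (L z)) (ContinuousLinearMap.adjoint L a) x := by
  intro v
  have := h (L v)
  rw [ContinuousLinearMap.adjoint_inner_left]
  simpa only [HasLineDerivAt, map_add, map_smul] using this

/-- By convexity the difference quotients from x towards y are at most Ψ y - Ψ x; pass to the limit.
-/
theorem HasGateauxGradientAt.le_of_isGammaZero {Ψ : E → ℝ}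
    (hΨ : IsGammaZero fun x => (Ψ x : EReal)) {x a : E} (h : HasGateauxGradientAt Ψ a x) (y : E) :
    Ψ x + inner ℝ a (y - x) ≤ Ψ y := by
  have hd : HasDerivAt (fun t : ℝ => Ψ (x + t • (y - x))) (inner ℝ a (y - x)) 0 := h (y - x)
  have hlim := hd.tendsto_slope_zero_right
  have hle : inner ℝ a (y - x) ≤ Ψ y - Ψ x := by
    refine le_of_tendsto hlim ?_
    filter_upwards [Ioo_mem_nhdsGT (zero_lt_one (α := ℝ))] with t ht
    obtain ⟨c, hc, hc'⟩ := hΨ.convex_real (x := y) (y := x) rfl rfl ht.1 ht.2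
    have hc : Ψ (t • y + (1 - t) • x) = c := by exact_mod_cast hc
    have e : x + (0 + t) • (y - x) = t • y + (1 - t) • x := by module
    rw [e, hc, zero_smul, add_zero, smul_eq_mul, inv_mul_le_iff₀ ht.1]
    linarith
  linarith

theorem tendsto_infDist_image (L : E →L[ℝ] E') {S : Set E} (hS : S.Nonempty) {y : ℕ → E}
    (h : Tendsto (fun n => Metric.infDist (y n) S) atTop (𝓝 0)) :
    Tendsto (fun n => Metric.infDist (L (y n)) (L '' S)) atTop (𝓝 0) := by
  -- The constant ‖L‖ + 1 rather than ‖L‖ allows division when L = 0.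
  refine squeeze_zero (g := fun n => (‖L‖ + 1) * Metric.infDist (y n) S)
    (fun n => Metric.infDist_nonneg) (fun n => ?_) (by simpa using h.const_mul (‖L‖ + 1))
  have hpos : 0 < ‖L‖ + 1 := by positivity
  rw [← div_le_iff₀' hpos]
  refine (Metric.le_infDist hS).2 fun z hz => ?_
  rw [div_le_iff₀' hpos]
  refine (Metric.infDist_le_dist_of_mem (Set.mem_image_of_mem L hz)).trans ?_
  rw [dist_eq_norm, dist_eq_norm, ← map_sub]
  refine (L.le_opNorm _).trans ?_
  gcongr
  linarith

end Gradient

theorem argminOn_image {α β γ : Type*} [LE γ] (F : β → γ) (L : α → β) (S : Set α) :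
    argminOn F (L '' S) = L '' argminOn (fun x => F (L x)) S := by
  ext y
  constructor
  · rintro ⟨⟨x, hx, rfl⟩, h⟩
    exact ⟨x, ⟨hx, fun z hz => h _ ⟨z, hz, rfl⟩⟩, rfl⟩
  · rintro ⟨x, ⟨hx, h⟩, rfl⟩
    refine ⟨⟨x, hx, rfl⟩, ?_⟩
    rintro _ ⟨z, hz, rfl⟩
    exact h z hz

/-! ### The coordinate form of the algorithm -/

section Iteration

variable {X : Type*} [NormedAddCommGroup X] [InnerProductSpace ℝ X] [CompleteSpace X] {m : ℕ}
  {T : ProdSpace X m → ProdSpace X m} {gradΨ : X → X} {α : ℝ} {lam : ℕ → ℝ}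
  {x xh : ℕ → ProdSpace X m} {xs : ℕ → X}

theorem IsIteration.star_eq (h : IsIteration T gradΨ α lam x xh xs) (n : ℕ) :
    xs (n + 1) = Xi X m (relax α T (x n)) := by
  rw [Xi_apply, h.star, h.half]
  rfl

theorem IsIteration.next_eq (h : IsIteration T gradΨ α lam x xh xs) (n : ℕ) :
    x (n + 1) = relax α T (x n) - lam (n + 1) •
      ContinuousLinearMap.adjoint (Xi X m) (gradΨ (Xi X m (relax α T (x n)))) := by
  ext j
  rw [h.next, h.star_eq, h.half, adjoint_Xi_apply]
  change relax α T (x n) j - _ = _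
  simp only [PiLp.sub_apply, PiLp.smul_apply, constVec_apply, smul_smul, mul_one_div]

theorem exists_isIteration_iff : (∃ xh xs, IsIteration T gradΨ α lam x xh xs) ↔
    ∀ n, x (n + 1) = relax α T (x n) - lam (n + 1) •
      ContinuousLinearMap.adjoint (Xi X m) (gradΨ (Xi X m (relax α T (x n)))) := by
  refine ⟨fun ⟨xh, xs, h⟩ n => h.next_eq n, fun h => ⟨fun n => relax α T (x n),
    -- The truncated subtraction matters only at n = 0, where the value is irrelevant.
    fun n => Xi X m (relax α T (x (n - 1))), fun n => rfl, fun n => ?_, fun n i => ?_⟩⟩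
  · rw [Nat.add_sub_cancel, Xi_apply]
    rfl
  · rw [Nat.add_sub_cancel, h, adjoint_Xi_apply]
    simp only [PiLp.sub_apply, PiLp.smul_apply, constVec_apply, smul_smul, mul_one_div]

end Iteration

end HSDM

theorem theorem2 {X : Type*} [NormedAddCommGroup X] [InnerProductSpace ℝ X] [CompleteSpace X]
    {m : ℕ} (f : X → EReal) (g : Fin m → ℝ → EReal) (A : Fin m → X →L[ℝ] ℝ)
    (Ψ : X → ℝ) (gradΨ : X → X)
    (hf : HSDM.IsGammaZero f) (hg : ∀ i, HSDM.IsGammaZero (g i)) (hA : ∀ i, A i ≠ 0)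
    (hS : (HSDM.solSet f g A).Nonempty) (hq : HSDM.Qualification f g A)
    (hΨ : HSDM.IsGammaZero fun x => (Ψ x : EReal))
    (hgrad : ∀ x, HSDM.HasGateauxGradientAt Ψ (gradΨ x) x)
    (hLip : ∃ κ, LipschitzWith κ gradΨ)
    (hΩ : (HSDM.argminOn Ψ (HSDM.solSet f g A)).Nonempty) :
    -- the proximity operators, evaluated with positive scalars instead of matrix inverses
    (∀ i, 0 < HSDM.sqGain (A i) ∧
      ∀ u, HSDM.proxSet (fun z => g i (A i z)) u = {HSDM.proxStep (g i) (A i) u}) ∧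
    HSDM.IsGammaZero (HSDM.sumFn f g A) ∧
    (∀ x, HSDM.proxSet (HSDM.sumFn f g A) x =
      {HSDM.tuple (fun i => HSDM.prox (fun z => g i (A i z)) (x i.castSucc))
        (HSDM.prox f (x (Fin.last m)))}) ∧
    (∀ x, HSDM.proxSet (HSDM.indicatorFn (HSDM.diagonal X m : Set (HSDM.ProdSpace X m))) x =
        {(HSDM.diagonal X m).starProjection x} ∧
      (HSDM.diagonal X m).starProjection x = WithLp.toLp 2 fun _ => HSDM.avg x) ∧
    -- the explicit operator is the Douglas-Rachford operator of `H` and the diagonal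
    (∀ x, HSDM.drsII f g A x =
      (2 : ℝ) • HSDM.prox (HSDM.sumFn f g A)
          ((2 : ℝ) • (HSDM.diagonal X m).starProjection x - x)
        - ((2 : ℝ) • (HSDM.diagonal X m).starProjection x - x)) ∧
    LipschitzWith 1 (HSDM.drsII f g A) ∧
    -- its fixed points, averaged, are the first stage solutions
    HSDM.solSet f g A = HSDM.Xi X m '' fixedPoints (HSDM.drsII f g A) ∧
    -- the second stage objective `Θ = Ψ ∘ Ξ` and the translated problem
    HSDM.IsGammaZero (fun x => (Ψ (HSDM.Xi X m x) : EReal)) ∧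
    (∀ x, HSDM.HasGateauxGradientAt (fun z => Ψ (HSDM.Xi X m z))
      (ContinuousLinearMap.adjoint (HSDM.Xi X m) (gradΨ (HSDM.Xi X m x))) x) ∧
    (∃ κ, LipschitzWith κ fun x =>
      ContinuousLinearMap.adjoint (HSDM.Xi X m) (gradΨ (HSDM.Xi X m x))) ∧
    HSDM.argminOn Ψ (HSDM.solSet f g A) =
      HSDM.Xi X m '' HSDM.argminOn (fun x => Ψ (HSDM.Xi X m x))
        (fixedPoints (HSDM.drsII f g A)) ∧
    -- plugging the operator into the hybrid steepest descent method
    (∀ α : ℝ, 0 < α → α < 1 →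
      fixedPoints (HSDM.relax α (HSDM.drsII f g A)) = fixedPoints (HSDM.drsII f g A) ∧
      HSDM.IsAttractingNonexpansive (HSDM.relax α (HSDM.drsII f g A)) ∧
      ∀ lam : ℕ → ℝ, (∀ n, 0 ≤ lam (n + 1)) → Summable (fun n => lam (n + 1) ^ 2) →
        ¬ Summable (fun n => lam (n + 1)) →
        (∀ x : ℕ → HSDM.ProdSpace X m,
          (∃ xh xs, HSDM.IsIteration (HSDM.drsII f g A) gradΨ α lam x xh xs) ↔
          ∀ n, x (n + 1) = HSDM.relax α (HSDM.drsII f g A) (x n) - lam (n + 1) •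
            ContinuousLinearMap.adjoint (HSDM.Xi X m)
              (gradΨ (HSDM.Xi X m (HSDM.relax α (HSDM.drsII f g A) (x n))))) ∧
        -- convergence, from every starting point `x 0`
        (FiniteDimensional ℝ X → Bornology.IsBounded (fixedPoints (HSDM.drsII f g A)) →
          ∀ (x xh : ℕ → HSDM.ProdSpace X m) (xs : ℕ → X),
            HSDM.IsIteration (HSDM.drsII f g A) gradΨ α lam x xh xs →
            Tendsto (fun n => Metric.infDist (xs n)
              (HSDM.argminOn Ψ (HSDM.solSet f g A))) atTop (𝓝 0))) := by
  have hfix : (fixedPoints (HSDM.drsII f g A)).Nonempty := by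
    rw [HSDM.solSet_eq_image hf hg hA hq] at hS
    exact hS.of_image
  have hT := HSDM.lipschitzWith_drsII hf hg hA
  have hΘgrad : ∀ x, HSDM.HasGateauxGradientAt (fun z => Ψ (HSDM.Xi X m z))
      (ContinuousLinearMap.adjoint (HSDM.Xi X m) (gradΨ (HSDM.Xi X m x))) x :=
    fun x => (hgrad _).comp (HSDM.Xi X m)
  have hΘ : HSDM.IsGammaZero fun x => (Ψ (HSDM.Xi X m x) : EReal) :=
    hΨ.comp (HSDM.Xi X m) ⟨0, EReal.coe_lt_top _⟩
  have hΘLip : ∃ κ, LipschitzWith κ fun x =>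
      ContinuousLinearMap.adjoint (HSDM.Xi X m) (gradΨ (HSDM.Xi X m x)) := by
    obtain ⟨κ, hκ⟩ := hLip
    exact ⟨_, (ContinuousLinearMap.adjoint (HSDM.Xi X m)).lipschitz.comp
      (hκ.comp (HSDM.Xi X m).lipschitz)⟩
  have hargmin : HSDM.argminOn Ψ (HSDM.solSet f g A) =
      HSDM.Xi X m '' HSDM.argminOn (fun x => Ψ (HSDM.Xi X m x))
        (fixedPoints (HSDM.drsII f g A)) := by
    rw [HSDM.solSet_eq_image hf hg hA hq, HSDM.argminOn_image]
  have hH := HSDM.isGammaZero_sumFn hf hg hA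
  refine ⟨fun i => ⟨HSDM.sqGain_pos (hA i), fun u =>
      ((hg i).comp_functional (hA i)).proxSet_eq (HSDM.proxStep_mem_proxSet (hg i) (hA i) u)⟩, hH,
    fun x => hH.proxSet_eq (HSDM.tuple_prox_mem_proxSet hf hg hA x),
    fun x => ⟨HSDM.proxSet_indicator_diagonal x, HSDM.starProjection_diagonal x⟩,
    HSDM.drsII_eq hf hg hA, hT, HSDM.solSet_eq_image hf hg hA hq, hΘ, hΘgrad, hΘLip, hargmin,
    fun α hα hα' => ⟨HSDM.fixedPoints_relax hα,
      HSDM.isAttractingNonexpansive_relax hT hα hα' hfix, fun lam hlam hlam2 hdiv =>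
      ⟨fun x => HSDM.exists_isIteration_iff, fun hfin hbdd x xh xs hit => ?_⟩⟩⟩
  have : ProperSpace (HSDM.ProdSpace X m) := FiniteDimensional.proper_real _
  obtain ⟨κ, hκ⟩ := hΘLip
  have hlim := HSDM.tendsto_infDist_hybrid_steepest_descent hT hα hα' hfix hbdd
    (Θ := fun x => Ψ (HSDM.Xi X m x)) (lam := fun n => lam (n + 1))
    (fun x y => (hΘgrad x).le_of_isGammaZero hΘ y) hκ hlam hlam2 hdiv hit.next_eq
  rw [hargmin] at hΩ ⊢
  -- Shift the index: only the terms `xs (n + 1)` are determined by the iteration.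
  rw [← tendsto_add_atTop_iff_nat 1]
  simp only [hit.star_eq]
  exact HSDM.tendsto_infDist_image (HSDM.Xi X m) hΩ.of_image hlim
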